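/- Let $k$ be a field, $S=k[x_1,\dots,x_n]$, $d\ge 1$, and let $I\subsetneq S$ be a Borel fixed ideal, i.e. a monomial ideal such that $(x_j/x_i)\,m\in I$ whenever $m$ lies in the set $G(I)$ of minimal monomial generators, $x_i\mid m$ and $j<i$. Assume $\deg m\le d$ for all $m\in G(I)$. Let $\tilde S=k[x_{i,j}\mid 1\le i\le n,\ 1\le j\le d]$ and $\Theta=\{x_{i,1}-x_{i,j}\mid 1\le i\le n,\ 2\le j\le d\}$, and identify $\tilde S/(\Theta)$ with $S$ via $x_{i,j}\mapsto x_i$. For a monomial $m=\prod_i x_i^{a_i}$ put $\nu(m)=\max\{i\mid a_i>0\}$ and $\tilde m=\prod_i\prod_{b_{i-1}<j\le b_i}x_{i,j}$, where $b_i=a_1+\dots+a_i$. Each monomial $m\in I$ has a unique factorization $m=m_1m_2$ with $m_1\in G(I)$ and every variable of $m_1$ of index at most that of every variable of $m_2$; put $g(m)=m_1$. For $m\in G(I)$ and $i<\nu(m)$ put $m_{\langle i\rangle}=g\big((x_i/x_l)\,m\big)$ with $l=\min\{l>i\mid a_l>0\}$. A pair $(\tilde F,\tilde m)$ with $m\in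 G(I)$ and $\tilde F=\{(i_1,j_1),\dots,(i_q,j_q)\}$, $q\ge 0$, is admissible if $1\le i_1<\dots<i_q<\nu(m)$ and $j_r=1+\sum_{l\le i_r}a_l$ for all $r$; write $\tilde F_r=\tilde F\setminus\{(i_r,j_r)\}$. Let $\tilde P_0=\tilde S$ and, for $q\ge 1$, let $\tilde P_q$ be the free $\tilde S$-module with basis the elements $e(\tilde F,\tilde m)$, $(\tilde F,\tilde m)$ admissible with $\#\tilde F=q-1$. Let $\partial e(\emptyset,\tilde m)=\tilde m$ and, for $\#\tilde F=q\ge 1$, $$\partial e(\tilde F,\tilde m)=\sum_{r=1}^q(-1)^r x_{i_r,j_r}\,e(\tilde F_r,\tilde m)-\sum_{r}(-1)^r\,\frac{x_{i_r,j_r}\tilde m}{\widetilde{m_{\langle i_r\rangle}}}\;e(\tilde F_r,\widetilde{m_{\langle i_r\rangle}}),$$ the second sum being over those $r$ for which $(\tilde F_r,\widetilde{m_{\langle i_r\rangle}})$ is admissible. (1) $\tilde P_\bullet\otimes_{\tilde S}\tilde S/(\Theta)$, with the augmentation $1\mapsto 1$ onto $S/I$, is a minimal $S$-free resolution of $S/I$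 (an exact complex of finitely generated free $S$-modules whose differentials have entries in $(x_1,\dots,x_n)$). It is $\mathbb Z^n$-graded, with $\deg 1=0$ for the basis element of $\tilde P_0$ and $\deg e(\tilde F,\tilde m)=\deg\big(m\prod_r x_{i_r}\big)$. The map $(\tilde F,\tilde m)\mapsto(\{i_1,\dots,i_q\},m)$ is a bijection from the admissible pairs onto the pairs $(F,m)$ with $m\in G(I)$ and $F\subseteq\{1,\dots,\nu(m)-1\}$, which index the basis elements $e(F,m)$ of the Eliahou–Kervaire resolution of $S/I$; the differential of the latter is $e(\emptyset,m)\mapsto m$ and, for $F=\{i_1<\dots<i_q\}$, $e(F,m)\mapsto\sum_r(-1)^r x_{i_r}e(F_r,m)-\sum_r(-1)^r\frac{x_{i_r}m}{m_r}e(F_r,m_r)$, where $F_r=F\setminus\{i_r\}$, $m_r=g(x_{i_r}m)$, and the second sum is over those $r$ with $F_r\subseteq\{1,\dots,\nu(m_r)-1\}$. (2) The two resolutions differ in general: for the Borel fixed ideal $I=(x_1^2,x_1x_2,x_1x_3,x_1x_4,x_2^2,x_2x_3,x_2x_4)\subset k[x_1,x_2,x_3,x_4]$ and $d=2$, the map of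 free modules sending each basis element to the basis element of the corresponding pair is not a chain map from $\tilde P_\bullet\otimes_{\tilde S}\tilde S/(\Theta)$ to the Eliahou–Kervaire resolution. Indeed there is an admissible pair $(\tilde F,\tilde m)$ with $\#\tilde F=3$ such that the image of $e(\tilde F,\tilde m)$ under the differential involves exactly five basis elements, while that of the corresponding $e(F,m)$ in the Eliahou–Kervaire resolution involves exactly four. -/

import Mathlib

open MvPolynomial TensorProduct

namespace BorelEK

noncomputable section

/-! ### Monomials, Borel fixed ideals

Monomials of `k[x_i | i ∈ σ]` are identified with their exponent vectors `σ →₀ ℕ`.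
All indices start at `0`: the variables of `S` are `x_0, …, x_{n-1}`. -/

/-- The ideal is generated by monomials. -/
def IsMonomialIdeal {k : Type*} [Field k] {n : ℕ} (I : Ideal (MvPolynomial (Fin n) k)) : Prop :=
  ∃ A : Set (Fin n →₀ ℕ), I = Ideal.span ((fun a => monomial a (1 : k)) '' A)

/-- `G(I)`, the minimal monomial generators: the monomials of `I` that are minimal with respect
to divisibility. -/
def G {k : Type*} [Field k] {n : ℕ} (I : Ideal (MvPolynomial (Fin n) k)) : Set (Fin n →₀ ℕ) :=
  {m | Minimal (fun a => monomial a (1 : k) ∈ I) m}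

/-- Borel fixed (strongly stable) monomial ideals. -/
def IsBorelFixed {k : Type*} [Field k] {n : ℕ} (I : Ideal (MvPolynomial (Fin n) k)) : Prop :=
  IsMonomialIdeal I ∧ ∀ m ∈ G I, ∀ i j : Fin n, m i ≠ 0 → j < i →
    monomial (m - Finsupp.single i 1 + Finsupp.single j 1) (1 : k) ∈ I

/-- `ν(m)`, the largest index of a variable dividing `m` (`⊥` for `m = 1`). -/
def nu {n : ℕ} (m : Fin n →₀ ℕ) : WithBot (Fin n) := m.support.max

/-- `m = m₁ * m₂` for some `m₂`, with `m₁ ∈ G(I)`, and every variable of `m₁` has index at most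
that of every variable of `m₂`. -/
def IsLeadingFactor {k : Type*} [Field k] {n : ℕ} (I : Ideal (MvPolynomial (Fin n) k))
    (m m₁ : Fin n →₀ ℕ) : Prop :=
  m₁ ∈ G I ∧ ∃ m₂ : Fin n →₀ ℕ, m = m₁ + m₂ ∧ ∀ i ∈ m₁.support, ∀ j ∈ m₂.support, i ≤ j

open Classical in
/-- `g(m)`, the factor `m₁` above (it exists and is unique for `m ∈ I` if `I` is Borel fixed;
the value `m` is a placeholder when there is none). -/
def g {k : Type*} [Field k] {n : ℕ} (I : Ideal (MvPolynomial (Fin n) k))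
    (m : Fin n →₀ ℕ) : Fin n →₀ ℕ :=
  if h : ∃ m₁, IsLeadingFactor I m m₁ then h.choose else m

/-- `𝔟_i(m) = (x_i / x_k) * m` with `k = min {j > i | x_j divides m}`, for `i < ν(m)`
(and `m` as a placeholder for other `i`). -/
def fb {n : ℕ} (i : Fin n) (m : Fin n →₀ ℕ) : Fin n →₀ ℕ :=
  if h : (m.support.filter (fun j => i < j)).Nonempty then
    m + Finsupp.single i 1 - Finsupp.single ((m.support.filter (fun j => i < j)).min' h) 1
  else m

open Classical in
/-- `m_⟨i⟩ = g(𝔟_i(m))` if `i < ν(m)`, and `m_⟨i⟩ = m` otherwise. -/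
def bracket {k : Type*} [Field k] {n : ℕ} (I : Ideal (MvPolynomial (Fin n) k))
    (m : Fin n →₀ ℕ) (i : Fin n) : Fin n →₀ ℕ :=
  if (i : WithBot (Fin n)) < nu m then g I (fb i m) else m

/-! ### The polarization and its resolution -/

/-- The exponent vector of the alternative polarization `m̃ = ∏ x_{i,j}`, over all `(i, j)` with
`∑_{l < i} a_l ≤ j < ∑_{l ≤ i} a_l` (here `j` starts at `0`), of `m = ∏ x_i ^ a_i`.  -/
def bpol {n : ℕ} (d : ℕ) (m : Fin n →₀ ℕ) : (Fin n × Fin d) →₀ ℕ :=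
  Finsupp.equivFunOnFinite.symm fun p =>
    if ∑ l ∈ Finset.Iio p.1, m l ≤ (p.2 : ℕ) ∧ (p.2 : ℕ) < ∑ l ∈ Finset.Iic p.1, m l then 1 else 0

/-- Admissible pairs `(F̃, m̃)`; as `m` determines `m̃` and conversely, we record `m`.
By `snd_eq` the first components of the elements of `F̃` are distinct. -/
structure Admissible {k : Type*} [Field k] {n : ℕ} (I : Ideal (MvPolynomial (Fin n) k)) {d : ℕ}
    (F : Finset (Fin n × Fin d)) (m : Fin n →₀ ℕ) : Prop where
  mem : m ∈ G I
  lt_nu : ∀ p ∈ F, (p.1 : WithBot (Fin n)) < nu m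
  snd_eq : ∀ p ∈ F, (p.2 : ℕ) = ∑ l ∈ Finset.Iic p.1, m l

/-- The index set of the basis of `P̃_q`: one element for `q = 0`, and the admissible pairs
`(F̃, m̃)` with `#F̃ = q - 1` for `q ≥ 1`. -/
def Idx {k : Type*} [Field k] {n : ℕ} (I : Ideal (MvPolynomial (Fin n) k)) (d : ℕ) : ℕ → Type
  | 0 => Unit
  | q + 1 => {a : Finset (Fin n × Fin d) × (Fin n →₀ ℕ) // Admissible I a.1 a.2 ∧ a.1.card = q}

/-- The free `S̃`-module `P̃_q`. -/
abbrev P {k : Type*} [Field k] {n : ℕ} (I : Ideal (MvPolynomial (Fin n) k)) (d q : ℕ) : Type _ :=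
  Idx I d q →₀ MvPolynomial (Fin n × Fin d) k

open Classical in
/-- The basis element `e(F̃, m̃)` of `P̃_{q+1}`, for an admissible pair with `#F̃ = q`
(and `0` as a placeholder otherwise). -/
def e {k : Type*} [Field k] {n : ℕ} (I : Ideal (MvPolynomial (Fin n) k)) {d : ℕ} (q : ℕ)
    (F : Finset (Fin n × Fin d)) (m : Fin n →₀ ℕ) : P I d (q + 1) :=
  if h : Admissible I F m ∧ F.card = q then
    Finsupp.single (show Idx I d (q + 1) from ⟨(F, m), h⟩) 1
  else 0

/-- The position `r ∈ {1, …, q}` of `p = (i_r, j_r)` in `F̃ = {(i_1, j_1), …, (i_q, j_q)}`,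
`i_1 < ⋯ < i_q`. -/
def pos {n d : ℕ} (F : Finset (Fin n × Fin d)) (p : Fin n × Fin d) : ℕ :=
  (F.filter fun p' => p'.1 ≤ p.1).card

open Classical in
/-- The differential `∂ : P̃_{q+1} → P̃_q`. -/
def diff {k : Type*} [Field k] {n : ℕ} (I : Ideal (MvPolynomial (Fin n) k)) (d : ℕ) :
    (q : ℕ) → P I d (q + 1) →ₗ[MvPolynomial (Fin n × Fin d) k] P I d q
  | 0 => Finsupp.linearCombination _ fun a : Idx I d 1 =>
      Finsupp.single (show Idx I d 0 from ()) (monomial (bpol d a.1.2) (1 : k))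
  | q + 1 => Finsupp.linearCombination _ fun a : Idx I d (q + 2) =>
      let F := a.1.1
      let m := a.1.2
      ∑ p ∈ F, ((-1) ^ pos F p * X p : MvPolynomial (Fin n × Fin d) k) • e I q (F.erase p) m
      - ∑ p ∈ F.filter (fun p => Admissible I (F.erase p) (bracket I m p.1)),
          ((-1) ^ pos F p *
            monomial (Finsupp.single p 1 + bpol d m - bpol d (bracket I m p.1)) (1 : k)) •
          e I q (F.erase p) (bracket I m p.1)

/-! ### Specialization along `Θ` -/

/-- `Θ = {x_{i,0} - x_{i,j} | j ≠ 0}`. -/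
def Theta (k : Type*) [Field k] (n d : ℕ) [NeZero d] : Set (MvPolynomial (Fin n × Fin d) k) :=
  {f | ∃ (i : Fin n) (j : Fin d), j ≠ 0 ∧ f = X (i, 0) - X (i, j)}

/-- `S̃ / (Θ)`. -/
abbrev QuotTheta (k : Type*) [Field k] (n d : ℕ) [NeZero d] : Type _ :=
  MvPolynomial (Fin n × Fin d) k ⧸ Ideal.span (Theta k n d)

/-- The isomorphism `S̃ / (Θ) ≅ S` induced by `x_{i,j} ↦ x_i`. -/
def quotThetaEquiv (k : Type*) [Field k] (n d : ℕ) [NeZero d] :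
    QuotTheta k n d ≃ₐ[k] MvPolynomial (Fin n) k :=
  AlgEquiv.ofAlgHom
    (Ideal.Quotient.liftₐ (Ideal.span (Theta k n d))
      (aeval fun p : Fin n × Fin d => (X p.1 : MvPolynomial (Fin n) k))
      (fun a ha => by
        have h : Ideal.span (Theta k n d) ≤ RingHom.ker
            (aeval fun p : Fin n × Fin d => (X p.1 : MvPolynomial (Fin n) k)) := by
          rw [Ideal.span_le]
          rintro f ⟨i, j, -, rfl⟩
          simp [RingHom.mem_ker]
        exact h ha))
    (aeval fun i => Ideal.Quotient.mkₐ k (Ideal.span (Theta k n d)) (X (i, 0)))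
    (by
      apply MvPolynomial.algHom_ext
      intro i
      rw [AlgHom.comp_apply, aeval_X]
      exact aeval_X _ _)
    (by
      apply Ideal.Quotient.algHom_ext
      apply MvPolynomial.algHom_ext
      rintro ⟨i, j⟩
      change aeval _ (aeval _ (X (i, j))) = Ideal.Quotient.mk (Ideal.span (Theta k n d)) (X (i, j))
      rw [aeval_X, aeval_X]
      by_cases hj : j = 0
      · subst hj; rfl
      · exact Ideal.Quotient.eq.mpr (Ideal.subset_span ⟨i, j, hj, rfl⟩))

/-- `P̃_q ⊗_{S̃} S̃ / (Θ)`. -/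
def TP {k : Type*} [Field k] {n : ℕ} (I : Ideal (MvPolynomial (Fin n) k)) (d : ℕ) [NeZero d]
    (q : ℕ) : Type _ :=
  QuotTheta k n d ⊗[MvPolynomial (Fin n × Fin d) k] P I d q

instance instAddCommGroupTP {k : Type*} [Field k] {n : ℕ} (I : Ideal (MvPolynomial (Fin n) k))
    (d : ℕ) [NeZero d] (q : ℕ) : AddCommGroup (TP I d q) :=
  inferInstanceAs
    (AddCommGroup (QuotTheta k n d ⊗[MvPolynomial (Fin n × Fin d) k] P I d q))

instance instModuleQuotTP {k : Type*} [Field k] {n : ℕ} (I : Ideal (MvPolynomial (Fin n) k))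
    (d : ℕ) [NeZero d] (q : ℕ) : Module (QuotTheta k n d) (TP I d q) :=
  inferInstanceAs
    (Module (QuotTheta k n d) (QuotTheta k n d ⊗[MvPolynomial (Fin n × Fin d) k] P I d q))

/-- `P̃_q ⊗_{S̃} S̃ / (Θ)` as an `S`-module through the isomorphism `S̃ / (Θ) ≅ S`. -/
instance instModuleTP {k : Type*} [Field k] {n : ℕ} (I : Ideal (MvPolynomial (Fin n) k))
    (d : ℕ) [NeZero d] (q : ℕ) : Module (MvPolynomial (Fin n) k) (TP I d q) :=
  Module.compHom (TP I d q) ((quotThetaEquiv k n d).symm.toRingEquiv.toRingHom)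

/-- The differential of `P̃_• ⊗_{S̃} S̃ / (Θ)`. -/
def tdiff {k : Type*} [Field k] {n : ℕ} (I : Ideal (MvPolynomial (Fin n) k)) (d : ℕ) [NeZero d]
    (q : ℕ) : TP I d (q + 1) →ₗ[MvPolynomial (Fin n) k] TP I d q where
  toFun x := (diff I d q).baseChange (QuotTheta k n d) x
  map_add' x y := ((diff I d q).baseChange (QuotTheta k n d)).map_add x y
  map_smul' s x := ((diff I d q).baseChange (QuotTheta k n d)).map_smul
    ((quotThetaEquiv k n d).symm s) x

/-- The `S`-basis of `P̃_q ⊗_{S̃} S̃ / (Θ)` induced by the basis of `P̃_q`. -/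
def tbasis {k : Type*} [Field k] {n : ℕ} (I : Ideal (MvPolynomial (Fin n) k)) (d : ℕ) [NeZero d]
    (q : ℕ) : Module.Basis (Idx I d q) (MvPolynomial (Fin n) k) (TP I d q) :=
  (show Module.Basis (Idx I d q) (QuotTheta k n d) (TP I d q) from
    Module.Basis.baseChange (QuotTheta k n d)
      (Finsupp.basisSingleOne : Module.Basis (Idx I d q) (MvPolynomial (Fin n × Fin d) k)
        (P I d q))).mapCoeffs (quotThetaEquiv k n d).toRingEquiv (fun c x =>
          congrArg (fun c' : QuotTheta k n d => c' • x)
            ((quotThetaEquiv k n d).symm_apply_apply c))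

/-- The augmentation `P̃_0 ⊗_{S̃} S̃ / (Θ) = S → S / I`, sending `1` to the class of `1`. -/
def augmentation {k : Type*} [Field k] {n : ℕ} (I : Ideal (MvPolynomial (Fin n) k)) (d : ℕ)
    [NeZero d] : TP I d 0 →ₗ[MvPolynomial (Fin n) k] MvPolynomial (Fin n) k ⧸ I :=
  (tbasis I d 0).constr (MvPolynomial (Fin n) k) fun _ => (1 : MvPolynomial (Fin n) k ⧸ I)

/-- The `ℤⁿ`-degree of a basis element: `0` for the basis element of `P̃_0`, and the degree of
`m * ∏_{(i,j) ∈ F̃} x_i` for `e(F̃, m̃)`. -/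
def mdeg {k : Type*} [Field k] {n : ℕ} (I : Ideal (MvPolynomial (Fin n) k)) (d : ℕ) :
    (q : ℕ) → Idx I d q → (Fin n →₀ ℕ)
  | 0, _ => 0
  | _ + 1, a => a.1.2 + ∑ p ∈ a.1.1, Finsupp.single p.1 1

/-- `⋯ → C_1 → C_0 → M → 0` is a minimal free resolution over `S = k[x_0, …, x_{n-1}]`: an exact
complex, with finitely generated free `C_q`, whose differentials have image in `(x_0, …, x_{n-1}) C_q`. -/
structure IsMinimalFreeResolution {k : Type*} [Field k] {n : ℕ} {C : ℕ → Type*}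
    [∀ q, AddCommGroup (C q)] [∀ q, Module (MvPolynomial (Fin n) k) (C q)]
    {M : Type*} [AddCommGroup M] [Module (MvPolynomial (Fin n) k) M]
    (δ : ∀ q, C (q + 1) →ₗ[MvPolynomial (Fin n) k] C q)
    (ε : C 0 →ₗ[MvPolynomial (Fin n) k] M) : Prop where
  free : ∀ q, Module.Free (MvPolynomial (Fin n) k) (C q)
  finite : ∀ q, Module.Finite (MvPolynomial (Fin n) k) (C q)
  exact : ∀ q, Function.Exact (δ (q + 1)) (δ q)
  exact_zero : Function.Exact (δ 0) ε
  surjective : Function.Surjective ε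
  minimal : ∀ q, LinearMap.range (δ q) ≤
    Ideal.span (Set.range (X : Fin n → MvPolynomial (Fin n) k)) • (⊤ : Submodule _ (C q))

/-- The maps `δ` are homogeneous of degree `0` for the grading by exponent vectors in which the
`i`-th element of the basis `b q` has degree `deg q i`. -/
def IsMultigraded {k : Type*} [Field k] {n : ℕ} {C : ℕ → Type*}
    [∀ q, AddCommGroup (C q)] [∀ q, Module (MvPolynomial (Fin n) k) (C q)]
    (δ : ∀ q, C (q + 1) →ₗ[MvPolynomial (Fin n) k] C q) {ι : ℕ → Type*}
    (b : ∀ q, Module.Basis (ι q) (MvPolynomial (Fin n) k) (C q))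
    (deg : ∀ q, ι q → (Fin n →₀ ℕ)) : Prop :=
  ∀ (q : ℕ) (i : ι (q + 1)) (j : ι q), ∀ c ∈ ((b q).repr (δ q (b (q + 1) i)) j).support,
    c + deg q j = deg (q + 1) i

/-! ### The Eliahou–Kervaire resolution -/

/-- Admissible pairs `(F, m)` for `I` in the sense of Eliahou and Kervaire. -/
def EKAdmissible {k : Type*} [Field k] {n : ℕ} (I : Ideal (MvPolynomial (Fin n) k))
    (F : Finset (Fin n)) (m : Fin n →₀ ℕ) : Prop :=
  m ∈ G I ∧ ∀ i ∈ F, (i : WithBot (Fin n)) < nu m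

/-- The index set of the basis in degree `q` of the Eliahou–Kervaire resolution of `S / I`. -/
def EKIdx {k : Type*} [Field k] {n : ℕ} (I : Ideal (MvPolynomial (Fin n) k)) : ℕ → Type
  | 0 => Unit
  | q + 1 => {a : Finset (Fin n) × (Fin n →₀ ℕ) // EKAdmissible I a.1 a.2 ∧ a.1.card = q}

/-- The modules of the Eliahou–Kervaire resolution. -/
abbrev EK {k : Type*} [Field k] {n : ℕ} (I : Ideal (MvPolynomial (Fin n) k)) (q : ℕ) : Type _ :=
  EKIdx I q →₀ MvPolynomial (Fin n) k

open Classical in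
/-- The basis element `e(F, m)` of the Eliahou–Kervaire resolution in degree `q + 1`, for an
admissible pair with `#F = q` (and `0` as a placeholder otherwise). -/
def eEK {k : Type*} [Field k] {n : ℕ} (I : Ideal (MvPolynomial (Fin n) k)) (q : ℕ)
    (F : Finset (Fin n)) (m : Fin n →₀ ℕ) : EK I (q + 1) :=
  if h : EKAdmissible I F m ∧ F.card = q then
    Finsupp.single (show EKIdx I (q + 1) from ⟨(F, m), h⟩) 1
  else 0

open Classical in
/-- The Eliahou–Kervaire differential:
`e(∅, m) ↦ m` and, for `F = {i_1 < ⋯ < i_q}`,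
`e(F, m) ↦ ∑_r (-1)^r x_{i_r} e(F_r, m) - ∑_r (-1)^r (x_{i_r} m / m_r) e(F_r, m_r)` where
`F_r = F \ {i_r}`, `m_r = g(x_{i_r} m)` and the second sum runs over those `r` for which
`(F_r, m_r)` is admissible. -/
def ekdiff {k : Type*} [Field k] {n : ℕ} (I : Ideal (MvPolynomial (Fin n) k)) :
    (q : ℕ) → EK I (q + 1) →ₗ[MvPolynomial (Fin n) k] EK I q
  | 0 => Finsupp.linearCombination _ fun a : EKIdx I 1 =>
      Finsupp.single (show EKIdx I 0 from ()) (monomial a.1.2 (1 : k))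
  | q + 1 => Finsupp.linearCombination _ fun a : EKIdx I (q + 2) =>
      let F := a.1.1
      let m := a.1.2
      ∑ i ∈ F, ((-1) ^ (F.filter (fun j => j ≤ i)).card * X i : MvPolynomial (Fin n) k) •
          eEK I q (F.erase i) m
      - ∑ i ∈ F.filter (fun i => EKAdmissible I (F.erase i) (g I (Finsupp.single i 1 + m))),
          ((-1) ^ (F.filter (fun j => j ≤ i)).card *
            monomial (Finsupp.single i 1 + m - g I (Finsupp.single i 1 + m)) (1 : k)) •
          eEK I q (F.erase i) (g I (Finsupp.single i 1 + m))

/-- The correspondence `({(i_1, j_1), …, (i_q, j_q)}, m̃) ↦ ({i_1, …, i_q}, m)` of admissible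
pairs (and the identity in degree `0`). -/
def corr {k : Type*} [Field k] {n : ℕ} (I : Ideal (MvPolynomial (Fin n) k)) (d : ℕ) :
    (q : ℕ) → Idx I d q → EKIdx I q
  | 0, _ => ()
  | _ + 1, a => ⟨(a.1.1.image Prod.fst, a.1.2), by
      obtain ⟨⟨F, m⟩, h, rfl⟩ := a
      refine ⟨⟨h.mem, ?_⟩, Finset.card_image_of_injOn ?_⟩
      · intro i hi
        obtain ⟨p, hp, rfl⟩ := Finset.mem_image.mp hi
        exact h.lt_nu p hp
      · intro p hp p' hp' hpp
        refine Prod.ext hpp (Fin.ext ?_)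
        rw [h.snd_eq p hp, h.snd_eq p' hp', hpp]⟩

/-- The `S`-linear map `P̃_q ⊗_{S̃} S̃ / (Θ) → EK_q` that sends the basis element of an admissible
pair to the basis element of the corresponding admissible pair. -/
def corrMap {k : Type*} [Field k] {n : ℕ} (I : Ideal (MvPolynomial (Fin n) k)) (d : ℕ) [NeZero d]
    (q : ℕ) : TP I d q →ₗ[MvPolynomial (Fin n) k] EK I q :=
  (tbasis I d q).constr (MvPolynomial (Fin n) k) fun a => Finsupp.single (corr I d q a) 1

/-- The ideal `(x_1², x_1x_2, x_1x_3, x_1x_4, x_2², x_2x_3, x_2x_4)` of `k[x_1, x_2, x_3, x_4]`. -/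
def exampleIdeal (k : Type*) [Field k] : Ideal (MvPolynomial (Fin 4) k) :=
  Ideal.span {X 0 ^ 2, X 0 * X 1, X 0 * X 2, X 0 * X 3, X 1 ^ 2, X 1 * X 2, X 1 * X 3}

end

end BorelEK

namespace BorelEK

/-! ### Partial sums of exponent vectors -/

/-! A monomial, written as a sorted word, is determined by its partial sums `ps m t`. In these terms
everything becomes arithmetic with `min` and `max`. A Borel fixed ideal is an upper set for the
dominance order (`IsBorelFixed.mem_of_ps_le`). The factor `g I m` is the truncation of `m` that is a
minimal generator. The monomial `m_⟨i⟩` is a truncation of a monomial whose partial sums beyond `i`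
are `max (ps m t) (ps m (i + 1) + 1)` (`ps_fb`, `ps_bracket`). Admissibility of the second-sum term
at `i` says that the column indices, which are partial sums, are unchanged at the other elements of
`F` and stay below the degree of `m_⟨i⟩`; this is `Good`.

After `x_{i,j} ↦ x_i` the complex lives on the Eliahou–Kervaire basis, with differential `sdiff`.
Its square vanishes because the part obtained by removing `i` and `j` is symmetric in `i` and `j` up
to sign (`ddterm_symm`). For `i < j` there are two cases. If `j` survives in `m_⟨i⟩`, then both
iterated brackets equal `g I (fb i (fb j m))`. If it does not, then `(m_⟨j⟩)_⟨i⟩ = m_⟨i⟩`, and the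
two terms carrying this monomial cancel on one side.

Exactness comes from the filtration by `wt m`. Brackets lower the weight, so the graded pieces are
Koszul complexes on the variables `x_f`, `f < ν(m)`. The usual matching of Koszul terms singles out
the `Up` terms. Every chain in positive degree is a boundary plus a combination of `Up` terms
(`wtSubmodule_le`), and the differential is injective on such combinations
(`eq_zero_of_mem_upSubmodule`): by Koszul contraction in higher degrees, and by uniqueness of the
factorization in the lowest. A cycle is therefore a boundary. Minimality holds since no coefficient
is a unit, by comparison of degrees.

The comparison `corrMap` carries `tdiff` to `sdiff` and is an isomorphism, because a column index is
determined by its row and by `m`. For the example, the terms of the two differentials of one basis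
element are counted. -/

/-- The number of letters of index `< t` in the monomial `m`. -/
def ps {n : ℕ} (m : Fin n →₀ ℕ) (t : ℕ) : ℕ := ∑ l with l.val < t, m l

section PartialSums

variable {n : ℕ}

lemma ps_zero (m : Fin n →₀ ℕ) : ps m 0 = 0 := by simp [ps]

lemma ps_succ (m : Fin n →₀ ℕ) (i : Fin n) : ps m (i + 1) = ps m i + m i := by
  have : (Finset.univ.filter fun l : Fin n => l.val < i.val + 1) =
      insert i (Finset.univ.filter fun l : Fin n => l.val < i.val) := by
    ext l
    simp only [Finset.mem_filter, Finset.mem_univ, true_and, Finset.mem_insert, Fin.ext_iff]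
    omega
  rw [ps, this, Finset.sum_insert (by simp), add_comm]
  rfl

lemma ps_of_le (m : Fin n →₀ ℕ) {t : ℕ} (h : n ≤ t) : ps m t = m.degree := by
  rw [ps, Finsupp.degree_eq_sum, Finset.filter_true_of_mem]
  intro l _
  omega

lemma ps_mono (m : Fin n →₀ ℕ) : Monotone (ps m) := fun s t h =>
  Finset.sum_le_sum_of_subset fun l => by
    simp only [Finset.mem_filter, Finset.mem_univ, true_and]
    omega

lemma ps_le_degree (m : Fin n →₀ ℕ) (t : ℕ) : ps m t ≤ m.degree := by
  rw [← ps_of_le m (le_max_left n t)]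
  exact ps_mono m (le_max_right n t)

lemma eq_of_ps_eq {a b : Fin n →₀ ℕ} (h : ∀ t, ps a t = ps b t) : a = b := by
  ext i
  have h1 := ps_succ a i
  have h2 := ps_succ b i
  rw [h, h] at h1
  omega

lemma ps_add (a b : Fin n →₀ ℕ) (t : ℕ) : ps (a + b) t = ps a t + ps b t := by
  simp [ps, Finset.sum_add_distrib]

lemma ps_le_ps_of_le {a b : Fin n →₀ ℕ} (h : a ≤ b) (t : ℕ) : ps a t ≤ ps b t :=
  Finset.sum_le_sum fun l _ => h l

lemma ps_single (i : Fin n) (c t : ℕ) :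
    ps (Finsupp.single i c) t = if i.val < t then c else 0 := by
  simp [ps, Finsupp.single_apply, Finset.sum_ite_eq]

lemma sum_Iic_eq_ps (m : Fin n →₀ ℕ) (i : Fin n) : ∑ l ∈ Finset.Iic i, m l = ps m (i + 1) := by
  refine Finset.sum_congr (Finset.ext fun l => ?_) fun _ _ => rfl
  rw [Finset.mem_Iic, Finset.mem_filter, Fin.le_def, Nat.lt_succ_iff]
  exact (and_iff_right (Finset.mem_univ l)).symm

lemma lt_nu_iff_exists (m : Fin n →₀ ℕ) (i : Fin n) :
    (i : WithBot (Fin n)) < nu m ↔ ∃ j, i < j ∧ m j ≠ 0 := by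
  rw [nu, Finset.max_eq_sup_withBot, Finset.lt_sup_iff]
  refine exists_congr fun j => ?_
  rw [Finsupp.mem_support_iff, WithBot.coe_lt_coe, and_comm]

lemma ps_lt_of_lt {m : Fin n →₀ ℕ} {s t : ℕ} (j : Fin n) (hs : s ≤ j.val) (ht : j.val < t)
    (hj : m j ≠ 0) : ps m s < ps m t := by
  have h1 := ps_mono m hs
  have h2 := ps_mono m (Nat.succ_le_of_lt ht)
  have h3 := ps_succ m j
  simp only [Nat.succ_eq_add_one] at h2
  omega

lemma exists_of_ps_lt {m : Fin n →₀ ℕ} {s t : ℕ} (h : ps m s < ps m t) :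
    ∃ j : Fin n, s ≤ j.val ∧ j.val < t ∧ m j ≠ 0 := by
  by_contra! hc
  refine absurd h (not_lt.mpr ?_)
  rw [ps, ps, Finset.sum_filter, Finset.sum_filter]
  refine Finset.sum_le_sum fun l _ => ?_
  have := hc l
  split_ifs <;> omega

lemma lt_nu_iff (m : Fin n →₀ ℕ) (i : Fin n) :
    (i : WithBot (Fin n)) < nu m ↔ ps m (i + 1) < m.degree := by
  rw [lt_nu_iff_exists, ← ps_of_le m le_rfl]
  constructor
  · rintro ⟨j, hj, h0⟩
    exact ps_lt_of_lt j (by rw [Fin.lt_def] at hj; omega) j.isLt h0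
  · intro h
    obtain ⟨j, h1, -, h3⟩ := exists_of_ps_lt h
    exact ⟨j, by rw [Fin.lt_def]; omega, h3⟩

/-- The monomial formed by the first `c` letters of `m`. -/
noncomputable def trunc (m : Fin n →₀ ℕ) (c : ℕ) : Fin n →₀ ℕ :=
  Finsupp.equivFunOnFinite.symm fun i => min (ps m (i + 1)) c - min (ps m i) c

lemma ps_trunc (m : Fin n →₀ ℕ) (c t : ℕ) : ps (trunc m c) t = min (ps m t) c := by
  have key : ∀ t ≤ n, ps (trunc m c) t = min (ps m t) c := by
    intro t
    induction t with
    | zero => simp [ps_zero]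
    | succ t ih =>
      intro ht
      have h1 := ps_succ (trunc m c) ⟨t, ht⟩
      have h2 : ps m t ≤ ps m (t + 1) := ps_mono m (Nat.le_succ t)
      simp only [trunc, Finsupp.equivFunOnFinite_symm_apply_apply] at h1
      rw [← trunc] at h1
      rw [h1, ih (by omega)]
      omega
  rcases le_total t n with ht | ht
  · exact key t ht
  · rw [ps_of_le _ ht, ps_of_le m ht, ← ps_of_le _ le_rfl, ← ps_of_le m le_rfl, key n le_rfl]

lemma degree_trunc (m : Fin n →₀ ℕ) (c : ℕ) : (trunc m c).degree = min m.degree c := by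
  rw [← ps_of_le _ le_rfl, ps_trunc, ps_of_le _ le_rfl]

/-- Exponents are increments of partial sums, and cutting off at `c` can only shrink an increment.
-/
lemma le_of_ps_eq_min {a m : Fin n →₀ ℕ} {c : ℕ} (h : ∀ t, ps a t = min (ps m t) c) : a ≤ m := by
  intro i
  have h1 := ps_succ a i
  have h2 := ps_succ m i
  rw [h, h] at h1
  omega

lemma eq_trunc {a m : Fin n →₀ ℕ} {c : ℕ} (h : ∀ t, ps a t = min (ps m t) c) : a = trunc m c :=
  eq_of_ps_eq fun t => by rw [h, ps_trunc]

lemma trunc_le (m : Fin n →₀ ℕ) (c : ℕ) : trunc m c ≤ m := le_of_ps_eq_min (ps_trunc m c)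

/-- Initial factors of a monomial are its truncations. -/
lemma ps_eq_min_of_add {a b : Fin n →₀ ℕ} (h : ∀ i ∈ a.support, ∀ j ∈ b.support, i ≤ j) (t : ℕ) :
    ps a t = min (ps (a + b) t) a.degree := by
  rw [ps_add]
  have h1 := ps_le_degree a t
  by_cases h2 : ps a t < a.degree
  · have : ps b t = 0 := by
      by_contra h0
      rw [← ps_of_le a (le_max_left n t)] at h2
      obtain ⟨i, hi, -, hi'⟩ := exists_of_ps_lt h2
      obtain ⟨j, -, hj, hj'⟩ := exists_of_ps_lt (m := b) (s := 0) (t := t) (by rw [ps_zero]; omega)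
      have := h i (by simpa using hi') j (by simpa using hj')
      rw [Fin.le_def] at this
      omega
    omega
  · omega

lemma add_support_le_of_trunc (m : Fin n →₀ ℕ) (c : ℕ) :
    ∀ i ∈ (trunc m c).support, ∀ j ∈ (m - trunc m c).support, i ≤ j := by
  intro i hi j hj
  by_contra! hlt
  rw [Finsupp.mem_support_iff] at hi hj
  rw [Fin.lt_def] at hlt
  have h1 := ps_succ (trunc m c) i
  have h2 := ps_succ (trunc m c) j
  have h3 := ps_succ m j
  have h4 := ps_mono m (show j.val + 1 ≤ i.val by omega)
  rw [ps_trunc, ps_trunc] at h1 h2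
  rw [Finsupp.tsub_apply] at hj
  omega

/-- The effect of `fb` on partial sums. -/
lemma ps_fb {m : Fin n →₀ ℕ} {i : Fin n} (hi : ps m (i + 1) < m.degree) (t : ℕ) :
    ps (fb i m) t = if i.val < t then max (ps m t) (ps m (i + 1) + 1) else ps m t := by
  have hne : (m.support.filter (fun j => i < j)).Nonempty := by
    obtain ⟨j, hj, hj'⟩ := (lt_nu_iff_exists m i).mp ((lt_nu_iff m i).mpr hi)
    exact ⟨j, by simp [hj, hj']⟩
  rw [fb, dif_pos hne]
  set l := (m.support.filter (fun j => i < j)).min' hne with hl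
  have hmem := Finset.min'_mem _ hne
  rw [← hl] at hmem
  simp only [Finset.mem_filter, Finsupp.mem_support_iff] at hmem
  have hmin : ∀ j, i < j → m j ≠ 0 → l ≤ j := fun j h1 h2 =>
    Finset.min'_le _ _ (by simp [h1, h2])
  -- The subtraction in `fb` is genuine, so adding `x_l` back gives an honest identity of partial
  -- sums.
  have hle : Finsupp.single l 1 ≤ m + Finsupp.single i 1 := by
    intro j
    rw [Finsupp.single_apply]
    split_ifs with h
    · subst h
      simp only [Finsupp.add_apply]
      omega
    · exact Nat.zero_le _
  have heq := congrArg (fun a => ps a t) (tsub_add_cancel_of_le hle)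
  simp only [ps_add, ps_single] at heq
  have hil : i.val < l.val := hmem.2
  by_cases h1 : i.val < t
  · rw [if_pos h1] at heq ⊢
    by_cases h2 : l.val < t
    · rw [if_pos h2] at heq
      have := ps_lt_of_lt (m := m) (s := i + 1) (t := t) l (by omega) h2 hmem.1
      omega
    · rw [if_neg h2] at heq
      -- For `i < t ≤ l` no letter of `m` lies strictly between `i` and `t`, by minimality of `l`.
      have h3 : ps m t = ps m (i + 1) := by
        refine le_antisymm (not_lt.mp fun h => ?_) (ps_mono m (by omega))
        obtain ⟨j, hj1, hj2, hj3⟩ := exists_of_ps_lt h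
        have := hmin j (by rw [Fin.lt_def]; omega) hj3
        rw [Fin.le_def] at this
        omega
      omega
  · rw [if_neg h1] at heq ⊢
    rw [if_neg (by omega)] at heq
    omega

lemma fb_le (i : Fin n) (m : Fin n →₀ ℕ) : fb i m ≤ m + Finsupp.single i 1 := by
  rw [fb]
  split_ifs
  · exact tsub_le_self
  · exact le_self_add

lemma degree_fb {m : Fin n →₀ ℕ} {i : Fin n} (hi : ps m (i + 1) < m.degree) :
    (fb i m).degree = m.degree := by
  rw [← ps_of_le _ le_rfl, ps_fb hi, if_pos i.isLt, ps_of_le _ le_rfl]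
  omega

end PartialSums

/-! ### Borel fixed ideals -/

section Borel

variable {k : Type*} [Field k] {n : ℕ} {I : Ideal (MvPolynomial (Fin n) k)}

lemma mem_of_le {a b : Fin n →₀ ℕ} (h : a ≤ b) (ha : monomial a (1 : k) ∈ I) :
    monomial b (1 : k) ∈ I := by
  have : monomial b (1 : k) = monomial (b - a) 1 * monomial a 1 := by
    rw [monomial_mul, tsub_add_cancel_of_le h, one_mul]
  rw [this]
  exact I.mul_mem_left _ ha

lemma exists_mem_G_le {a : Fin n →₀ ℕ} (ha : monomial a (1 : k) ∈ I) : ∃ b ∈ G I, b ≤ a := by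
  obtain ⟨b, hb, hmin⟩ := exists_minimal_le_of_wellFoundedLT
    (fun a : Fin n →₀ ℕ => monomial a (1 : k) ∈ I) a ha
  exact ⟨b, hmin, hb⟩

lemma IsMonomialIdeal.mem_of_coeff_ne_zero (hI : IsMonomialIdeal I) {f : MvPolynomial (Fin n) k}
    (hf : f ∈ I) {a : Fin n →₀ ℕ} (ha : coeff a f ≠ 0) : monomial a (1 : k) ∈ I := by
  obtain ⟨A, rfl⟩ := hI
  obtain ⟨b, hb, hba⟩ := mem_ideal_span_monomial_image.mp hf a (mem_support_iff.mpr ha)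
  exact mem_of_le hba (Ideal.subset_span ⟨b, hb, rfl⟩)

/-- The exchange property passes from generators to all monomials: take a generator `b` dividing the
monomial. Either `x_i` divides `b` and the exchange is made there, or `b` still divides the result.
-/
lemma IsBorelFixed.move_mem (hI : IsBorelFixed I) {a : Fin n →₀ ℕ}
    (ha : monomial a (1 : k) ∈ I) {i j : Fin n} (hi : a i ≠ 0) (hji : j < i) :
    monomial (a - Finsupp.single i 1 + Finsupp.single j 1) (1 : k) ∈ I := by
  obtain ⟨b, hb, hba⟩ := exists_mem_G_le ha
  by_cases h : b i = 0
  · refine mem_of_le ?_ hb.1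
    intro l
    have := hba l
    simp only [Finsupp.add_apply, Finsupp.tsub_apply, Finsupp.single_apply]
    split_ifs <;> subst_vars <;> omega
  · refine mem_of_le ?_ (hI.2 b hb i j h hji)
    intro l
    have := hba l
    simp only [Finsupp.add_apply, Finsupp.tsub_apply, Finsupp.single_apply]
    split_ifs <;> omega

/-- The monomials of a Borel fixed ideal form an upper set for the dominance order. -/
lemma IsBorelFixed.mem_of_ps_le (hI : IsBorelFixed I) {a b : Fin n →₀ ℕ}
    (ha : monomial a (1 : k) ∈ I) (hab : ∀ t, ps a t ≤ ps b t) : monomial b (1 : k) ∈ I := by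
  -- The degree of the truncated difference `a - b` measures the excess of `a` over `b`. One Borel
  -- move lowers it by one and keeps the dominance inequality.
  induction hN : (a - b).degree using Nat.strong_induction_on generalizing a with
  | _ N ih =>
    by_cases hle : a ≤ b
    · exact mem_of_le hle ha
    have hex : (Finset.univ.filter fun t => b t < a t).Nonempty := by
      rw [Finsupp.le_def] at hle
      push Not at hle
      obtain ⟨t, ht⟩ := hle
      exact ⟨t, by simpa using ht⟩
    obtain ⟨t, ht, htmin⟩ := Finset.exists_min_image _ (fun t => t) hex
    simp only [Finset.mem_filter, Finset.mem_univ, true_and] at ht htmin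
    have hbelow : ∀ l < t, a l ≤ b l := fun l hl => not_lt.mp fun h => absurd (htmin l h) (by simpa)
    -- Since `a` exceeds `b` at `t` but its partial sum through `t` does not, `b` must be strictly
    -- larger at some earlier place.
    have hs : ∃ s < t, a s < b s := by
      by_contra! hc
      have h1 := hab (t + 1)
      rw [ps_succ, ps_succ] at h1
      have h2 : ps b t ≤ ps a t := Finset.sum_le_sum fun l hl => hc l (by simpa using hl)
      omega
    obtain ⟨s, hst, hs⟩ := hs
    have hsingle : Finsupp.single t 1 ≤ a := by
      intro l
      rw [Finsupp.single_apply]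
      split_ifs with h
      · subst h; omega
      · exact Nat.zero_le _
    refine ih _ ?_ (hI.move_mem ha (i := t) (j := s) (by omega) hst) ?_ rfl
    · have : (a - Finsupp.single t 1 + Finsupp.single s 1 - b) + Finsupp.single t 1 = a - b := by
        ext l
        simp only [Finsupp.add_apply, Finsupp.tsub_apply, Finsupp.single_apply]
        split_ifs <;> subst_vars <;> omega
      have h2 := congrArg Finsupp.degree this
      rw [map_add, Finsupp.degree_single] at h2
      omega
    · intro u
      have h1 := congrArg (fun a => ps a u) (tsub_add_cancel_of_le hsingle)
      simp only [ps_add, ps_single] at h1 ⊢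
      have h2 := hab u
      rw [Fin.lt_def] at hst
      by_cases h3 : s.val < u
      · by_cases h4 : t.val < u
        · rw [if_pos h3]
          rw [if_pos h4] at h1
          omega
        -- For `s < u ≤ t` the move raises the partial sum by one. There is room, because `a ≤ b`
        -- below `t` with strict inequality at `s`.
        · have h5 : ps a u < ps b u := Finset.sum_lt_sum
            (fun l hl => hbelow l (by rw [Fin.lt_def]; simp at hl; omega)) ⟨s, by simpa using h3, hs⟩
          rw [if_pos h3]
          rw [if_neg h4] at h1
          omega
      · rw [if_neg h3]
        split_ifs at h1 <;> omega

lemma ps_eq_min_of_isLeadingFactor {m m₁ : Fin n →₀ ℕ} (h : IsLeadingFactor I m m₁) (t : ℕ) :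
    ps m₁ t = min (ps m t) m₁.degree := by
  obtain ⟨-, m₂, rfl, h⟩ := h
  exact ps_eq_min_of_add h t

/-- A proper divisor in `I`, of degree `c' < c`, is dominated by the truncation of `m` at `c'`. That
shorter truncation would then lie in `I`. -/
lemma mem_G_of_minimal_trunc (hI : IsBorelFixed I) {m : Fin n →₀ ℕ} {c : ℕ}
    (hc : monomial (trunc m c) (1 : k) ∈ I) (hmin : ∀ c' < c, monomial (trunc m c') (1 : k) ∉ I) :
    trunc m c ∈ G I := by
  refine ⟨hc, fun b hb hle => ?_⟩
  by_contra hne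
  have hdeg : b.degree < c := by
    by_contra! h
    refine hne (le_of_eq ?_)
    obtain ⟨x, hx⟩ := exists_add_of_le hle
    have h1 := congrArg Finsupp.degree hx
    rw [map_add, degree_trunc] at h1
    have : x = 0 := by
      rw [← Finsupp.degree_eq_zero_iff]
      omega
    rw [hx, this, add_zero]
  refine hmin _ hdeg (hI.mem_of_ps_le hb fun t => ?_)
  have h1 := ps_le_ps_of_le hle t
  have h2 := ps_le_degree b t
  rw [ps_trunc] at h1 ⊢
  omega

lemma exists_isLeadingFactor (hI : IsBorelFixed I) {m : Fin n →₀ ℕ}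
    (hm : monomial m (1 : k) ∈ I) : ∃ m₁, IsLeadingFactor I m m₁ := by
  classical
  have hex : ∃ c, monomial (trunc m c) (1 : k) ∈ I :=
    ⟨m.degree, by rwa [← eq_trunc fun t => (min_eq_left (ps_le_degree m t)).symm]⟩
  refine ⟨trunc m (Nat.find hex), mem_G_of_minimal_trunc hI (Nat.find_spec hex)
    (fun c' => Nat.find_min hex), m - trunc m (Nat.find hex), ?_, add_support_le_of_trunc _ _⟩
  rw [add_tsub_cancel_of_le (trunc_le _ _)]

lemma isLeadingFactor_g (hI : IsBorelFixed I) {m : Fin n →₀ ℕ} (hm : monomial m (1 : k) ∈ I) :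
    IsLeadingFactor I m (g I m) := by
  have h := exists_isLeadingFactor hI hm
  rw [g, dif_pos h]
  exact h.choose_spec

lemma g_mem_G (hI : IsBorelFixed I) {m : Fin n →₀ ℕ} (hm : monomial m (1 : k) ∈ I) :
    g I m ∈ G I := (isLeadingFactor_g hI hm).1

lemma ps_g (hI : IsBorelFixed I) {m : Fin n →₀ ℕ} (hm : monomial m (1 : k) ∈ I) (t : ℕ) :
    ps (g I m) t = min (ps m t) (g I m).degree :=
  ps_eq_min_of_isLeadingFactor (isLeadingFactor_g hI hm) t

lemma g_le (hI : IsBorelFixed I) {m : Fin n →₀ ℕ} (hm : monomial m (1 : k) ∈ I) :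
    g I m ≤ m := le_of_ps_eq_min (ps_g hI hm)

lemma g_degree_le_of_trunc_mem (hI : IsBorelFixed I) {m : Fin n →₀ ℕ}
    (hm : monomial m (1 : k) ∈ I) {c : ℕ} (hc : monomial (trunc m c) (1 : k) ∈ I) :
    (g I m).degree ≤ c := by
  by_contra! hlt
  -- A truncation in `I` shorter than `g I m` would divide this minimal generator properly.
  have hle : trunc m c ≤ g I m := le_of_ps_eq_min (c := c) fun t => by
    rw [ps_trunc, ps_g hI hm]
    omega
  have h1 := Finsupp.degree_mono ((g_mem_G hI hm).2 hc hle)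
  rw [degree_trunc] at h1
  omega

/-- The degree of `g` is antitone for the dominance order. -/
lemma g_degree_anti (hI : IsBorelFixed I) {a b : Fin n →₀ ℕ} (ha : monomial a (1 : k) ∈ I)
    (hab : ∀ t, ps a t ≤ ps b t) : (g I b).degree ≤ (g I a).degree := by
  -- The truncation of `b` at the degree of `g I a` dominates `g I a`, so it lies in `I`.
  refine g_degree_le_of_trunc_mem hI (hI.mem_of_ps_le ha hab)
    (hI.mem_of_ps_le (g_mem_G hI ha).1 fun t => ?_)
  have := hab t
  rw [ps_g hI ha, ps_trunc]
  omega

/-- `g m` is the only minimal generator which is a truncation of `m`. -/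
lemma g_eq_of_ps (hI : IsBorelFixed I) {m a : Fin n →₀ ℕ} (hm : monomial m (1 : k) ∈ I)
    (ha : a ∈ G I) (h : ∀ t, ps a t = min (ps m t) a.degree) : g I m = a := by
  have h1 : (g I m).degree ≤ a.degree :=
    g_degree_le_of_trunc_mem hI hm (by rw [← eq_trunc h]; exact ha.1)
  have h2 : g I m ≤ a := le_of_ps_eq_min (c := (g I m).degree) fun t => by
    rw [ps_g hI hm, h]
    omega
  exact le_antisymm h2 (ha.2 (g_mem_G hI hm).1 h2)

/-- Monomials with the same truncation in the ideal have the same leading factor. -/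
lemma g_congr (hI : IsBorelFixed I) {a b : Fin n →₀ ℕ} {c : ℕ}
    (hc : monomial (trunc a c) (1 : k) ∈ I) (h : ∀ t, min (ps a t) c = min (ps b t) c) :
    g I a = g I b := by
  have ha := mem_of_le (trunc_le a c) hc
  have hab : trunc a c = trunc b c := eq_trunc fun t => by rw [ps_trunc, h]
  have hb : monomial b (1 : k) ∈ I := mem_of_le (trunc_le b c) (hab ▸ hc)
  have h1 := g_degree_le_of_trunc_mem hI ha hc
  refine (g_eq_of_ps hI hb (g_mem_G hI ha) fun t => ?_).symm
  have := h t
  rw [ps_g hI ha]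
  omega

lemma g_eq_self (hI : IsBorelFixed I) {m : Fin n →₀ ℕ} (hm : m ∈ G I) : g I m = m :=
  g_eq_of_ps hI hm.1 hm fun t => (min_eq_left (ps_le_degree m t)).symm

lemma fb_mem (hI : IsBorelFixed I) {m : Fin n →₀ ℕ} (hm : monomial m (1 : k) ∈ I) {i : Fin n}
    (hi : ps m (i + 1) < m.degree) : monomial (fb i m) (1 : k) ∈ I :=
  hI.mem_of_ps_le hm fun t => by
    rw [ps_fb hi]
    split_ifs <;> omega

end Borel

end BorelEK

namespace BorelEK

/-! ### The operation `m ↦ m_⟨i⟩` -/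

section Bracket

variable {k : Type*} [Field k] {n : ℕ} {I : Ideal (MvPolynomial (Fin n) k)}

lemma bracket_eq {m : Fin n →₀ ℕ} {i : Fin n} (hi : ps m (i + 1) < m.degree) :
    bracket I m i = g I (fb i m) := by
  rw [bracket, if_pos ((lt_nu_iff m i).mpr hi)]

lemma bracket_mem_G (hI : IsBorelFixed I) {m : Fin n →₀ ℕ} (hm : m ∈ G I) {i : Fin n}
    (hi : ps m (i + 1) < m.degree) : bracket I m i ∈ G I := by
  rw [bracket_eq hi]
  exact g_mem_G hI (fb_mem hI hm.1 hi)

lemma bracket_le (hI : IsBorelFixed I) {m : Fin n →₀ ℕ} (hm : m ∈ G I) {i : Fin n}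
    (hi : ps m (i + 1) < m.degree) : bracket I m i ≤ Finsupp.single i 1 + m := by
  rw [bracket_eq hi, add_comm]
  exact (g_le hI (fb_mem hI hm.1 hi)).trans (fb_le i m)

lemma ps_bracket (hI : IsBorelFixed I) {m : Fin n →₀ ℕ} (hm : m ∈ G I) {i : Fin n}
    (hi : ps m (i + 1) < m.degree) (t : ℕ) :
    ps (bracket I m i) t = min (if i.val < t then max (ps m t) (ps m (i + 1) + 1) else ps m t)
      (bracket I m i).degree := by
  rw [bracket_eq hi, ps_g hI (fb_mem hI hm.1 hi), ps_fb hi]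

lemma bracket_degree_le (hI : IsBorelFixed I) {m : Fin n →₀ ℕ} (hm : m ∈ G I) {i : Fin n}
    (hi : ps m (i + 1) < m.degree) : (bracket I m i).degree ≤ m.degree := by
  rw [bracket_eq hi, ← degree_fb hi]
  exact Finsupp.degree_mono (g_le hI (fb_mem hI hm.1 hi))

/-- `m_⟨i⟩` is divisible by `x_i` times the part of `m` in the variables of index at most `i`. -/
lemma lt_bracket_degree (hI : IsBorelFixed I) {m : Fin n →₀ ℕ} (hm : m ∈ G I) {i : Fin n}
    (hi : ps m (i + 1) < m.degree) : ps m (i + 1) < (bracket I m i).degree := by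
  by_contra! hle
  -- If the leading factor ended before the new letter `x_i`, it would be a truncation of `m`.
  -- Minimality of `m` would force it to be all of `m`, against the degree bound.
  have h : bracket I m i ≤ m := le_of_ps_eq_min (c := (bracket I m i).degree) fun t => by
    rw [ps_bracket hI hm hi]
    split_ifs with h
    · have := ps_mono m (Nat.succ_le_of_lt h)
      simp only [Nat.succ_eq_add_one] at this
      omega
    · rfl
  have := Finsupp.degree_mono (hm.2 (bracket_mem_G hI hm hi).1 h)
  omega

/-- The condition under which the term `e(F \ {i}, m_⟨i⟩)` occurs in the differential of
`e(F, m)`. -/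
def Good (I : Ideal (MvPolynomial (Fin n) k)) (F : Finset (Fin n)) (m : Fin n →₀ ℕ)
    (i : Fin n) : Prop :=
  ∀ f ∈ F, f ≠ i → ps (bracket I m i) (f + 1) = ps m (f + 1) ∧
    ps m (f + 1) < (bracket I m i).degree

/-- The partial sums of the monomial obtained from `m` by `fb j` and then `fb i`. -/
lemma ps_fb_fb {m : Fin n →₀ ℕ} {i j : Fin n} (hij : i < j) (hi : ps m (i + 1) < m.degree)
    (hj : ps m (j + 1) < m.degree) (t : ℕ) :
    ps (fb i (fb j m)) t = max (if i.val < t then max (ps m t) (ps m (i + 1) + 1) else ps m t)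
      (if j.val < t then max (ps m t) (ps m (j + 1) + 1) else ps m t) := by
  rw [Fin.lt_def] at hij
  have h1 : ps (fb j m) (i + 1) = ps m (i + 1) := by rw [ps_fb hj, if_neg (by omega)]
  rw [ps_fb (by rwa [h1, degree_fb hj]), h1, ps_fb hj]
  split_ifs <;> omega

lemma fb_fb_mem (hI : IsBorelFixed I) {m : Fin n →₀ ℕ} (hm : m ∈ G I) {i j : Fin n} (hij : i < j)
    (hi : ps m (i + 1) < m.degree) (hj : ps m (j + 1) < m.degree) :
    monomial (fb i (fb j m)) (1 : k) ∈ I :=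
  hI.mem_of_ps_le hm.1 fun t => by
    rw [ps_fb_fb hij hi hj]
    split_ifs <;> omega

/-- A modification at `j` leaves the smaller indices alone, so `i < j` always survives in `m_⟨j⟩`.
The converse can fail, and this asymmetry is the source of the case distinction in the proof that
the square vanishes. -/
lemma ps_bracket_of_lt (hI : IsBorelFixed I) {m : Fin n →₀ ℕ} (hm : m ∈ G I) {i j : Fin n}
    (hij : i < j) (hj : ps m (j + 1) < m.degree) :
    ps (bracket I m j) (i + 1) = ps m (i + 1) ∧ ps m (i + 1) < (bracket I m j).degree := by
  rw [Fin.lt_def] at hij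
  have h1 := lt_bracket_degree hI hm hj
  have h2 := ps_mono m (show i.val + 1 ≤ j + 1 by omega)
  rw [ps_bracket hI hm hj, if_neg (by omega)]
  omega

/-- The leading factor depends only on an initial segment that already lies in the ideal. -/
lemma g_trunc (hI : IsBorelFixed I) {a : Fin n →₀ ℕ} {c : ℕ}
    (hc : monomial (trunc a c) (1 : k) ∈ I) : g I (trunc a c) = g I a :=
  (g_congr hI hc fun t => by rw [ps_trunc]; omega).symm

/-- Truncating between the two modifications does no harm: `fb i` applied to the truncation of `fb j
m` is itself a truncation of `fb i (fb j m)`. -/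
lemma bracket_bracket (hI : IsBorelFixed I) {m : Fin n →₀ ℕ} (hm : m ∈ G I) {i j : Fin n}
    (hij : i < j) (hi : ps m (i + 1) < m.degree) (hj : ps m (j + 1) < m.degree) :
    bracket I (bracket I m j) i = g I (fb i (fb j m)) := by
  obtain ⟨h1, h2⟩ := ps_bracket_of_lt hI hm hij hj
  have hi' : ps (bracket I m j) (i + 1) < (bracket I m j).degree := by omega
  have h : fb i (bracket I m j) = trunc (fb i (fb j m)) (bracket I m j).degree :=
    eq_trunc fun t => by
      rw [ps_fb hi', h1, ps_bracket hI hm hj, ps_fb_fb hij hi hj]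
      rw [Fin.lt_def] at hij
      split_ifs <;> omega
  rw [bracket_eq hi', h]
  exact g_trunc hI (h ▸ fb_mem hI (bracket_mem_G hI hm hj).1 hi')

/-- In the opposite order the same argument needs `j` to survive in `m_⟨i⟩`; then both orders lead
to the same monomial. -/
lemma bracket_bracket' (hI : IsBorelFixed I) {m : Fin n →₀ ℕ} (hm : m ∈ G I) {i j : Fin n}
    (hij : i < j) (hi : ps m (i + 1) < m.degree) (hj : ps m (j + 1) < m.degree)
    (h1 : ps (bracket I m i) (j + 1) = ps m (j + 1))
    (h2 : ps m (j + 1) < (bracket I m i).degree) :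
    bracket I (bracket I m i) j = g I (fb i (fb j m)) := by
  have hj' : ps (bracket I m i) (j + 1) < (bracket I m i).degree := by omega
  have h : fb j (bracket I m i) = trunc (fb i (fb j m)) (bracket I m i).degree :=
    eq_trunc fun t => by
      rw [ps_fb hj', h1, ps_bracket hI hm hi, ps_fb_fb hij hi hj]
      split_ifs <;> omega
  rw [bracket_eq hj', h]
  exact g_trunc hI (h ▸ fb_mem hI (bracket_mem_G hI hm hi).1 hj')

/-- Failure of `j` has two causes: `m` has no letter with index in `(i, j]`, or `m_⟨i⟩` ends by
position `ps m (j + 1)`. In both cases the extra modification at `j` is invisible in the first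
`(bracket I m i).degree` letters. -/
lemma g_fb_fb_of_not (hI : IsBorelFixed I) {m : Fin n →₀ ℕ} (hm : m ∈ G I) {i j : Fin n}
    (hij : i < j) (hi : ps m (i + 1) < m.degree) (hj : ps m (j + 1) < m.degree)
    (h : ¬ (ps (bracket I m i) (j + 1) = ps m (j + 1) ∧ ps m (j + 1) < (bracket I m i).degree)) :
    g I (fb i (fb j m)) = bracket I m i := by
  have hij' := Fin.lt_def.mp hij
  have hmono := ps_mono m (show i.val + 1 ≤ j + 1 by omega)
  have hfb := fb_mem hI hm.1 hi
  have hc : monomial (trunc (fb i m) (bracket I m i).degree) (1 : k) ∈ I := by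
    have : bracket I m i = trunc (fb i m) (bracket I m i).degree := eq_trunc fun t => by
      rw [bracket_eq hi, ps_g hI hfb]
    exact this ▸ (bracket_mem_G hI hm hi).1
  rw [bracket_eq hi] at hc h ⊢
  refine (g_congr hI hc fun t => ?_).symm
  rw [ps_g hI hfb, ps_fb hi, if_pos (by omega)] at h
  rw [ps_fb_fb hij hi hj, ps_fb hi]
  by_cases ht : j.val < t
  · have := ps_mono m (Nat.succ_le_of_lt ht)
    simp only [Nat.succ_eq_add_one] at this
    rw [if_pos ht, if_pos (by omega)]
    omega
  · rw [if_neg ht]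
    split_ifs <;> omega

section Pair

variable {F : Finset (Fin n)} {m : Fin n →₀ ℕ} {i j : Fin n}

lemma good_erase_of_lt (hI : IsBorelFixed I) (hm : m ∈ G I) (hij : i < j)
    (hj : ps m (j + 1) < m.degree) : Good I (F.erase i) m j ↔ Good I F m j := by
  constructor
  · intro h f hf hfj
    by_cases hfi : f = i
    · rw [hfi]
      exact ps_bracket_of_lt hI hm hij hj
    · exact h f (Finset.mem_erase.mpr ⟨hfi, hf⟩) hfj
  · exact fun h f hf => h f (Finset.mem_of_mem_erase hf)

/-- The terms `e(F \ {i, j}, (m_⟨j⟩)_⟨i⟩)` with `i < j`. -/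
lemma good_and_good_iff (hI : IsBorelFixed I) (hm : m ∈ G I) (hij : i < j)
    (hi : ps m (i + 1) < m.degree) (hj : ps m (j + 1) < m.degree) :
    Good I F m j ∧ Good I (F.erase j) (bracket I m j) i ↔
      ∀ f ∈ F, f ≠ i → f ≠ j → ps (fb i (fb j m)) (f + 1) = ps m (f + 1) ∧
        ps m (f + 1) < (g I (fb i (fb j m))).degree := by
  have hW := fb_fb_mem hI hm hij hi hj
  constructor
  · rintro ⟨h1, h2⟩ f hf hfi hfj
    have h3 := h1 f hf hfj
    have h4 := h2 f (Finset.mem_erase.mpr ⟨hfj, hf⟩) hfi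
    rw [bracket_bracket hI hm hij hi hj, ps_g hI hW] at h4
    omega
  · intro h
    have key : Good I F m j := by
      intro f hf hfj
      by_cases hfi : f = i
      · rw [hfi]
        exact ps_bracket_of_lt hI hm hij hj
      -- The doubly modified monomial dominates `fb j m`, so its leading factor is no longer. A
      -- bound against the shorter degree therefore implies the bound for `m_⟨j⟩`.
      · obtain ⟨h1, h2⟩ := h f hf hfi hfj
        have h3 : (g I (fb i (fb j m))).degree ≤ (bracket I m j).degree := by
          rw [bracket_eq hj]
          refine g_degree_anti hI (fb_mem hI hm.1 hj) fun t => ?_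
          rw [ps_fb_fb hij hi hj, ps_fb hj]
          omega
        rw [ps_fb_fb hij hi hj] at h1
        rw [ps_bracket hI hm hj]
        split_ifs at h1 ⊢ <;> omega
    refine ⟨key, fun f hf hfi => ?_⟩
    obtain ⟨hfj, hf⟩ := Finset.mem_erase.mp hf
    have h3 := h f hf hfi hfj
    have h4 := key f hf hfj
    rw [bracket_bracket hI hm hij hi hj, ps_g hI hW]
    omega

/-- Both orders are governed by the same condition on `fb i (fb j m)`. -/
lemma good_and_good_iff' (hI : IsBorelFixed I) (hm : m ∈ G I) (hij : i < j)
    (hi : ps m (i + 1) < m.degree) (hj : ps m (j + 1) < m.degree)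
    (hs : ps (bracket I m i) (j + 1) = ps m (j + 1) ∧ ps m (j + 1) < (bracket I m i).degree) :
    Good I F m i ∧ Good I (F.erase i) (bracket I m i) j ↔
      Good I F m j ∧ Good I (F.erase j) (bracket I m j) i := by
  rw [good_and_good_iff hI hm hij hi hj]
  have hW := fb_fb_mem hI hm hij hi hj
  constructor
  · rintro ⟨h1, h2⟩ f hf hfi hfj
    have h3 := h1 f hf hfi
    have h4 := h2 f (Finset.mem_erase.mpr ⟨hfi, hf⟩) hfj
    rw [bracket_bracket' hI hm hij hi hj hs.1 hs.2, ps_g hI hW] at h4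
    omega
  · intro h
    have key : Good I F m i := by
      intro f hf hfi
      by_cases hfj : f = j
      · rwa [hfj]
      · obtain ⟨h1, h2⟩ := h f hf hfi hfj
        have h3 : (g I (fb i (fb j m))).degree ≤ (bracket I m i).degree := by
          rw [bracket_eq hi]
          refine g_degree_anti hI (fb_mem hI hm.1 hi) fun t => ?_
          rw [ps_fb_fb hij hi hj, ps_fb hi]
          omega
        rw [ps_fb_fb hij hi hj] at h1
        rw [ps_bracket hI hm hi]
        split_ifs at h1 ⊢ <;> omega
    refine ⟨key, fun f hf hfj => ?_⟩
    obtain ⟨hfi, hf⟩ := Finset.mem_erase.mp hf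
    have h3 := h f hf hfi hfj
    have h4 := key f hf hfi
    rw [bracket_bracket' hI hm hij hi hj hs.1 hs.2, ps_g hI hW]
    omega

lemma good_erase_iff (hs : ps (bracket I m i) (j + 1) = ps m (j + 1) ∧
      ps m (j + 1) < (bracket I m i).degree) : Good I (F.erase j) m i ↔ Good I F m i := by
  constructor
  · intro h f hf hfi
    by_cases hfj : f = j
    · rwa [hfj]
    · exact h f (Finset.mem_erase.mpr ⟨hfj, hf⟩) hfi
  · exact fun h f hf => h f (Finset.mem_of_mem_erase hf)

/-- The occurrence criterion needed for the cancellation: the two terms with monomial `m_⟨i⟩` are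
present or absent together. Both conditions only test indices other than `i` and `j`, and there the
modification at `j` does not matter. -/
lemma good_erase_iff_of_not (hI : IsBorelFixed I) (hm : m ∈ G I) (hij : i < j)
    (hi : ps m (i + 1) < m.degree) (hj : ps m (j + 1) < m.degree)
    (hs : ¬ (ps (bracket I m i) (j + 1) = ps m (j + 1) ∧
      ps m (j + 1) < (bracket I m i).degree)) :
    Good I (F.erase j) m i ↔ Good I F m j ∧ Good I (F.erase j) (bracket I m j) i := by
  rw [good_and_good_iff hI hm hij hi hj, g_fb_fb_of_not hI hm hij hi hj hs]
  have hij' := Fin.lt_def.mp hij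
  have hmono := ps_mono m (show i.val + 1 ≤ j + 1 by omega)
  have key : ∀ f : Fin n, (ps (bracket I m i) (f + 1) = ps m (f + 1) ∧
      ps m (f + 1) < (bracket I m i).degree) ↔ (ps (fb i (fb j m)) (f + 1) = ps m (f + 1) ∧
      ps m (f + 1) < (bracket I m i).degree) := by
    intro f
    rw [ps_bracket hI hm hi, if_pos (by omega)] at hs
    rw [ps_bracket hI hm hi, ps_fb_fb hij hi hj]
    by_cases hf : j.val < f + 1
    · have := ps_mono m (Nat.succ_le_of_lt hf)
      simp only [Nat.succ_eq_add_one] at this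
      rw [if_pos hf, if_pos (by omega)]
      omega
    · rw [if_neg hf]
      split_ifs <;> omega
  constructor
  · intro h f hf hfi hfj
    exact (key f).mp (h f (Finset.mem_erase.mpr ⟨hfj, hf⟩) hfi)
  · intro h f hf hfi
    obtain ⟨hfj, hf⟩ := Finset.mem_erase.mp hf
    exact (key f).mpr (h f hf hfi hfj)

end Pair

/-- The weight `∑ (i + 1) a_i` of `∏ x_i ^ a_i`. -/
def wt (m : Fin n →₀ ℕ) : ℕ := ∑ i, (i.val + 1) * m i

lemma wt_fb_lt {m : Fin n →₀ ℕ} {i : Fin n} (hi : ps m (i + 1) < m.degree) :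
    wt (fb i m) < wt m := by
  have hne : (m.support.filter (fun j => i < j)).Nonempty := by
    obtain ⟨j, hj, hj'⟩ := (lt_nu_iff_exists m i).mp ((lt_nu_iff m i).mpr hi)
    exact ⟨j, by simp [hj, hj']⟩
  rw [fb, dif_pos hne]
  set l := (m.support.filter (fun j => i < j)).min' hne with hl
  have hmem := Finset.min'_mem _ hne
  rw [← hl] at hmem
  simp only [Finset.mem_filter, Finsupp.mem_support_iff, Fin.lt_def] at hmem
  have hle : Finsupp.single l 1 ≤ m + Finsupp.single i 1 := by
    rw [Finsupp.single_le_iff, Finsupp.add_apply]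
    omega
  have heq := congrArg wt (tsub_add_cancel_of_le hle)
  simp only [wt, Finsupp.add_apply, mul_add, Finset.sum_add_distrib, Finsupp.single_apply,
    mul_ite, mul_one, mul_zero, Finset.sum_ite_eq, Finset.mem_univ, if_true] at heq ⊢
  omega

lemma wt_mono {a b : Fin n →₀ ℕ} (h : a ≤ b) : wt a ≤ wt b :=
  Finset.sum_le_sum fun i _ => Nat.mul_le_mul_left _ (h i)

/-- This makes the second sum of the differential a lower-order perturbation of the Koszul
differential. -/
lemma wt_bracket_lt (hI : IsBorelFixed I) {m : Fin n →₀ ℕ} (hm : m ∈ G I) {i : Fin n}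
    (hi : ps m (i + 1) < m.degree) : wt (bracket I m i) < wt m := by
  rw [bracket_eq hi]
  exact (wt_mono (g_le hI (fb_mem hI hm.1 hi))).trans_lt (wt_fb_lt hi)

end Bracket

end BorelEK

namespace BorelEK

/-! ### The specialized complex

The complex with the basis of the Eliahou–Kervaire resolution and the differential obtained from
that of `P̃_•` by `x_{i,j} ↦ x_i`. -/

noncomputable section

section Complex

variable {k : Type*} [Field k] {n : ℕ} (I : Ideal (MvPolynomial (Fin n) k))

/-- The sign attached to `i ∈ F`. -/
def sg (k : Type*) [Field k] {n : ℕ} (F : Finset (Fin n)) (i : Fin n) : MvPolynomial (Fin n) k :=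
  (-1) ^ (F.filter (fun j => j ≤ i)).card

open Classical in
/-- The terms of the differential of `e(F, m)` belonging to `i ∈ F`, up to sign. -/
def dterm (q : ℕ) (F : Finset (Fin n)) (m : Fin n →₀ ℕ) (i : Fin n) : EK I (q + 1) :=
  (X i : MvPolynomial (Fin n) k) • eEK I q (F.erase i) m -
    if Good I F m i then
      monomial (Finsupp.single i 1 + m - bracket I m i) (1 : k) •
        eEK I q (F.erase i) (bracket I m i)
    else 0

/-- The specialized differential. -/
def sdiff : (q : ℕ) → EK I (q + 1) →ₗ[MvPolynomial (Fin n) k] EK I q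
  | 0 => Finsupp.linearCombination _ fun a : EKIdx I 1 =>
      Finsupp.single (show EKIdx I 0 from ()) (monomial a.1.2 (1 : k))
  | q + 1 => Finsupp.linearCombination _ fun a : EKIdx I (q + 2) =>
      ∑ i ∈ a.1.1, sg k a.1.1 i • dterm I q a.1.1 a.1.2 i

variable {I}

lemma eEK_eq_single {q : ℕ} {F : Finset (Fin n)} {m : Fin n →₀ ℕ}
    (h : EKAdmissible I F m ∧ F.card = q) :
    eEK I q F m = Finsupp.single (show EKIdx I (q + 1) from ⟨(F, m), h⟩) 1 := by
  rw [eEK, dif_pos h]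

lemma single_eq_eEK {q : ℕ} (a : EKIdx I (q + 1)) :
    Finsupp.single a (1 : MvPolynomial (Fin n) k) = eEK I q a.1.1 a.1.2 := by
  rw [eEK_eq_single a.2]
  rfl

lemma EK_hom_ext {q : ℕ} {M : Type*} [AddCommMonoid M] [Module (MvPolynomial (Fin n) k) M]
    {φ ψ : EK I (q + 1) →ₗ[MvPolynomial (Fin n) k] M}
    (h : ∀ F m, EKAdmissible I F m → F.card = q → φ (eEK I q F m) = ψ (eEK I q F m)) : φ = ψ := by
  refine Finsupp.lhom_ext' fun a => LinearMap.ext_ring ?_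
  have := h a.1.1 a.1.2 a.2.1 a.2.2
  rw [← single_eq_eEK] at this
  exact this

lemma sdiff_zero_eEK {F : Finset (Fin n)} {m : Fin n →₀ ℕ}
    (h : EKAdmissible I F m ∧ F.card = 0) :
    sdiff I 0 (eEK I 0 F m) = Finsupp.single (show EKIdx I 0 from ()) (monomial m (1 : k)) := by
  rw [eEK_eq_single h, sdiff]
  exact (Finsupp.linearCombination_single _ _ _).trans (one_smul _ _)

lemma sdiff_succ_eEK {q : ℕ} {F : Finset (Fin n)} {m : Fin n →₀ ℕ}
    (h : EKAdmissible I F m ∧ F.card = q + 1) :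
    sdiff I (q + 1) (eEK I (q + 1) F m) = ∑ i ∈ F, sg k F i • dterm I q F m i := by
  rw [eEK_eq_single h, sdiff]
  exact (Finsupp.linearCombination_single _ _ _).trans (one_smul _ _)

lemma EKAdmissible.ps_lt {F : Finset (Fin n)} {m : Fin n →₀ ℕ} (h : EKAdmissible I F m)
    {i : Fin n} (hi : i ∈ F) : ps m (i + 1) < m.degree :=
  (lt_nu_iff m i).mp (h.2 i hi)

lemma EKAdmissible.erase {F : Finset (Fin n)} {m : Fin n →₀ ℕ} (h : EKAdmissible I F m)
    (i : Fin n) : EKAdmissible I (F.erase i) m :=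
  ⟨h.1, fun f hf => h.2 f (Finset.mem_of_mem_erase hf)⟩

lemma EKAdmissible.erase_bracket (hI : IsBorelFixed I) {F : Finset (Fin n)} {m : Fin n →₀ ℕ}
    (h : EKAdmissible I F m) {i : Fin n} (hi : i ∈ F) (hg : Good I F m i) :
    EKAdmissible I (F.erase i) (bracket I m i) := by
  refine ⟨bracket_mem_G hI h.1 (h.ps_lt hi), fun f hf => ?_⟩
  obtain ⟨hfi, hf⟩ := Finset.mem_erase.mp hf
  have := hg f hf hfi
  rw [lt_nu_iff]
  omega

/-! ### The square of the specialized differential -/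

lemma sg_mul_sg {F : Finset (Fin n)} {i j : Fin n} (hi : i ∈ F) (hj : j ∈ F) (hij : i ≠ j) :
    sg k F i * sg k (F.erase i) j = -(sg k F j * sg k (F.erase j) i) := by
  have key : ∀ {i j : Fin n}, i ∈ F → i < j →
      sg k F i * sg k (F.erase i) j = -(sg k F j * sg k (F.erase j) i) := by
    intro i j hi hij
    have h1 : (F.erase j).filter (· ≤ i) = F.filter (· ≤ i) := by
      ext l
      simp only [Finset.mem_filter, Finset.mem_erase]
      exact ⟨fun h => ⟨h.1.2, h.2⟩, fun h => ⟨⟨(h.2.trans_lt hij).ne, h.1⟩, h.2⟩⟩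
    have h2 : (F.filter (· ≤ j)).card = ((F.erase i).filter (· ≤ j)).card + 1 := by
      rw [Finset.filter_erase, Finset.card_erase_add_one]
      exact Finset.mem_filter.mpr ⟨hi, hij.le⟩
    rw [sg, sg, sg, sg, h1, h2, pow_succ]
    ring
  rcases lt_or_gt_of_ne hij with h | h
  · exact key hi h
  · rw [key hj h, neg_neg]

open Classical in
/-- The part of `∂∂e(F, m)` obtained by removing first `i` and then `j`, up to sign. -/
def ddterm (I : Ideal (MvPolynomial (Fin n) k)) (q : ℕ) (F : Finset (Fin n)) (m : Fin n →₀ ℕ)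
    (i j : Fin n) : EK I (q + 1) :=
  (X i : MvPolynomial (Fin n) k) • dterm I q (F.erase i) m j -
    if Good I F m i then
      monomial (Finsupp.single i 1 + m - bracket I m i) (1 : k) •
        dterm I q (F.erase i) (bracket I m i) j
    else 0

/-- The multiple of `e(F, M)` by `x^w / M`. -/
def homTerm (I : Ideal (MvPolynomial (Fin n) k)) (q : ℕ) (F : Finset (Fin n)) (w M : Fin n →₀ ℕ) :
    EK I (q + 1) := monomial (w - M) (1 : k) • eEK I q F M

lemma ite_smul_sub_ite {R M : Type*} [Ring R] [AddCommGroup M] [Module R M] (p q : Prop)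
    [Decidable p] [Decidable q] (r : R) (x y : M) :
    (if p then r • (x - if q then y else 0) else 0) =
      (if p then r • x else 0) - if p ∧ q then r • y else 0 := by
  split_ifs <;> simp_all [smul_sub]

-- All four terms are multiples of basis elements with the same index set and the same total
-- monomial `x_i x_j m`. Symmetry in `i` and `j` thus reduces to comparing generators and occurrence
-- conditions.
open Classical in
lemma ddterm_eq (hI : IsBorelFixed I) {q : ℕ} {F : Finset (Fin n)} {m : Fin n →₀ ℕ}
    (h : EKAdmissible I F m) {i j : Fin n} (hi : i ∈ F) (hj : j ∈ F) (hij : i ≠ j) :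
    ddterm I q F m i j =
      homTerm I q ((F.erase i).erase j) (Finsupp.single i 1 + Finsupp.single j 1 + m) m -
      (if Good I (F.erase i) m j then homTerm I q ((F.erase i).erase j)
        (Finsupp.single i 1 + Finsupp.single j 1 + m) (bracket I m j) else 0) -
      (if Good I F m i then homTerm I q ((F.erase i).erase j)
        (Finsupp.single i 1 + Finsupp.single j 1 + m) (bracket I m i) else 0) +
      (if Good I F m i ∧ Good I (F.erase i) (bracket I m i) j then homTerm I q
        ((F.erase i).erase j) (Finsupp.single i 1 + Finsupp.single j 1 + m)
        (bracket I (bracket I m i) j) else 0) := by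
  have hbi := bracket_le hI h.1 (h.ps_lt hi)
  have hbj := bracket_le hI h.1 (h.ps_lt hj)
  have e1 : (X i : MvPolynomial (Fin n) k) * X j =
      monomial (Finsupp.single i 1 + Finsupp.single j 1 + m - m) 1 := by
    rw [add_tsub_cancel_right, X, X, monomial_mul, one_mul]
  have e2 : (X i : MvPolynomial (Fin n) k) * monomial (Finsupp.single j 1 + m - bracket I m j) 1 =
      monomial (Finsupp.single i 1 + Finsupp.single j 1 + m - bracket I m j) 1 := by
    rw [X, monomial_mul, one_mul, add_assoc, add_tsub_assoc_of_le hbj]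
  have e3 : monomial (Finsupp.single i 1 + m - bracket I m i) (1 : k) * X j =
      monomial (Finsupp.single i 1 + Finsupp.single j 1 + m - bracket I m i) 1 := by
    rw [X, monomial_mul, one_mul, add_right_comm, ← tsub_add_eq_add_tsub hbi]
  have e4 : Good I F m i → monomial (Finsupp.single i 1 + m - bracket I m i) (1 : k) *
      monomial (Finsupp.single j 1 + bracket I m i - bracket I (bracket I m i) j) 1 =
      monomial (Finsupp.single i 1 + Finsupp.single j 1 + m - bracket I (bracket I m i) j) 1 := by
    intro hg
    have hjj := h.erase_bracket hI hi hg
    have hb := bracket_le hI hjj.1 (hjj.ps_lt (Finset.mem_erase.mpr ⟨hij.symm, hj⟩))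
    rw [monomial_mul, one_mul, ← add_tsub_assoc_of_le hb, add_left_comm,
      tsub_add_cancel_of_le hbi, ← add_assoc, add_comm (Finsupp.single j 1)]
  rw [ddterm, dterm, dterm, smul_sub, smul_ite, smul_zero, ite_smul_sub_ite, smul_smul, smul_smul,
    smul_smul, e1, e2, e3, homTerm, homTerm, homTerm, homTerm]
  have e5 : (if Good I F m i ∧ Good I (F.erase i) (bracket I m i) j then
      monomial (Finsupp.single i 1 + m - bracket I m i) (1 : k) •
      monomial (Finsupp.single j 1 + bracket I m i - bracket I (bracket I m i) j) (1 : k) •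
        eEK I q ((F.erase i).erase j) (bracket I (bracket I m i) j) else 0) =
      if Good I F m i ∧ Good I (F.erase i) (bracket I m i) j then
        monomial (Finsupp.single i 1 + Finsupp.single j 1 + m -
          bracket I (bracket I m i) j) (1 : k) •
        eEK I q ((F.erase i).erase j) (bracket I (bracket I m i) j) else 0 := by
    split_ifs with hg
    · rw [smul_smul, e4 hg.1]
    · rfl
  rw [e5]
  abel

lemma ddterm_symm_of_lt (hI : IsBorelFixed I) {q : ℕ} {F : Finset (Fin n)} {m : Fin n →₀ ℕ}
    (h : EKAdmissible I F m) {i j : Fin n} (hi : i ∈ F) (hj : j ∈ F) (hij : i < j) :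
    ddterm I q F m i j = ddterm I q F m j i := by
  classical
  have hi' := h.ps_lt hi
  have hj' := h.ps_lt hj
  rw [ddterm_eq hI h hi hj hij.ne, ddterm_eq hI h hj hi hij.ne',
    Finset.erase_right_comm (a := j) (b := i), add_comm (Finsupp.single j 1) (Finsupp.single i 1)]
  have h1 : Good I (F.erase i) m j ↔ Good I F m j := good_erase_of_lt hI h.1 hij hj'
  by_cases hs : ps (bracket I m i) (j + 1) = ps m (j + 1) ∧ ps m (j + 1) < (bracket I m i).degree
  · have h2 : Good I (F.erase j) m i ↔ Good I F m i := good_erase_iff hs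
    have h3 := good_and_good_iff' (F := F) hI h.1 hij hi' hj' hs
    have h4 : bracket I (bracket I m i) j = bracket I (bracket I m j) i := by
      rw [bracket_bracket' hI h.1 hij hi' hj' hs.1 hs.2, bracket_bracket hI h.1 hij hi' hj']
    simp only [h1, h2, h3, h4]
    abel
  -- Here the term at `m_⟨i⟩` disappears when `i` is removed first. When `j` is removed first, it
  -- appears in the single and in the double bracket with opposite signs.
  · have h2 : ¬ Good I F m i := fun hg => hs (hg j hj hij.ne')
    have h3 := good_erase_iff_of_not (F := F) hI h.1 hij hi' hj' hs
    have h4 : bracket I (bracket I m j) i = bracket I m i := by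
      rw [bracket_bracket hI h.1 hij hi' hj', g_fb_fb_of_not hI h.1 hij hi' hj' hs]
    simp only [h1, h2, h3, h4, false_and, if_false]
    abel

lemma ddterm_symm (hI : IsBorelFixed I) {q : ℕ} {F : Finset (Fin n)} {m : Fin n →₀ ℕ}
    (h : EKAdmissible I F m) {i j : Fin n} (hi : i ∈ F) (hj : j ∈ F) (hij : i ≠ j) :
    ddterm I q F m i j = ddterm I q F m j i := by
  rcases lt_or_gt_of_ne hij with h' | h'
  · exact ddterm_symm_of_lt hI h hi hj h'
  · exact (ddterm_symm_of_lt hI h hj hi h').symm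

lemma sdiff_dterm (hI : IsBorelFixed I) {q : ℕ} {F : Finset (Fin n)} {m : Fin n →₀ ℕ}
    (h : EKAdmissible I F m) (hF : F.card = q + 2) {i : Fin n} (hi : i ∈ F) :
    sdiff I (q + 1) (dterm I (q + 1) F m i) =
      ∑ j ∈ F.erase i, sg k (F.erase i) j • ddterm I q F m i j := by
  have hc : (F.erase i).card = q + 1 := by rw [Finset.card_erase_of_mem hi, hF]; rfl
  rw [dterm, map_sub, map_smul, sdiff_succ_eEK ⟨h.erase i, hc⟩]
  by_cases hg : Good I F m i
  · rw [if_pos hg, map_smul, sdiff_succ_eEK ⟨h.erase_bracket hI hi hg, hc⟩, Finset.smul_sum,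
      Finset.smul_sum, ← Finset.sum_sub_distrib]
    refine Finset.sum_congr rfl fun j _ => ?_
    rw [ddterm, if_pos hg, smul_sub, smul_comm (X i), smul_comm (monomial _ _)]
  · rw [if_neg hg, map_zero, sub_zero, Finset.smul_sum]
    refine Finset.sum_congr rfl fun j _ => ?_
    rw [ddterm, if_neg hg, sub_zero, smul_comm (X i)]

lemma sdiff_sdiff_succ (hI : IsBorelFixed I) (q : ℕ) :
    sdiff I (q + 1) ∘ₗ sdiff I (q + 2) = 0 := by
  refine EK_hom_ext fun F m h hF => ?_
  rw [LinearMap.comp_apply, LinearMap.zero_apply, sdiff_succ_eEK ⟨h, hF⟩, map_sum]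
  have h1 : ∀ i ∈ F, sdiff I (q + 1) (sg k F i • dterm I (q + 1) F m i) =
      ∑ j ∈ F.erase i, (sg k F i * sg k (F.erase i) j) • ddterm I q F m i j := by
    intro i hi
    rw [map_smul, sdiff_dterm hI h hF hi, Finset.smul_sum]
    exact Finset.sum_congr rfl fun j _ => smul_smul _ _ _
  rw [Finset.sum_congr rfl h1, Finset.sum_sigma']
  -- Exchanging `i` and `j` keeps the term and reverses the sign.
  refine Finset.sum_involution (fun p _ => ⟨p.2, p.1⟩) ?_ ?_ ?_ ?_
  · rintro ⟨i, j⟩ hp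
    simp only [Finset.mem_sigma, Finset.mem_erase] at hp
    rw [ddterm_symm hI h hp.1 hp.2.2 hp.2.1.symm, sg_mul_sg hp.1 hp.2.2 hp.2.1.symm, neg_smul,
      neg_add_cancel]
  · rintro ⟨i, j⟩ hp - heq
    simp only [Finset.mem_sigma, Finset.mem_erase] at hp
    exact hp.2.1 (congrArg Sigma.fst heq)
  · rintro ⟨i, j⟩ hp
    simp only [Finset.mem_sigma, Finset.mem_erase] at hp ⊢
    exact ⟨hp.2.2, hp.2.1.symm, hp.1⟩
  · rintro ⟨i, j⟩ hp
    rfl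

lemma sdiff_sdiff_zero (hI : IsBorelFixed I) : sdiff I 0 ∘ₗ sdiff I 1 = 0 := by
  refine EK_hom_ext fun F m h hF => ?_
  rw [LinearMap.comp_apply, LinearMap.zero_apply, sdiff_succ_eEK ⟨h, hF⟩, map_sum]
  obtain ⟨i, rfl⟩ := Finset.card_eq_one.mp hF
  have hi := Finset.mem_singleton_self i
  -- With a singleton there is no other index to test, so both terms occur, and each maps to `x_i
  -- m`.
  have hg : Good I {i} m i := fun f hf hfi => absurd (Finset.mem_singleton.mp hf) hfi
  have hc : (Finset.erase {i} i).card = 0 := by simp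
  rw [Finset.sum_singleton, map_smul, dterm, if_pos hg, map_sub, map_smul, map_smul,
    sdiff_zero_eEK ⟨h.erase i, hc⟩, sdiff_zero_eEK ⟨h.erase_bracket hI hi hg, hc⟩,
    Finsupp.smul_single, Finsupp.smul_single, smul_eq_mul, smul_eq_mul, X, monomial_mul,
    monomial_mul, tsub_add_cancel_of_le (bracket_le hI h.1 (h.ps_lt hi)), sub_self, smul_zero]

lemma sdiff_comp_sdiff (hI : IsBorelFixed I) : ∀ q, sdiff I q ∘ₗ sdiff I (q + 1) = 0
  | 0 => sdiff_sdiff_zero hI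
  | q + 1 => sdiff_sdiff_succ hI q

end Complex

end

end BorelEK

namespace BorelEK

/-! ### Exactness of the specialized complex -/

noncomputable section

section Exactness

variable {k : Type*} [Field k] {n : ℕ} {I : Ideal (MvPolynomial (Fin n) k)}

lemma monomial_smul_eEK_apply {q : ℕ} {F : Finset (Fin n)} {m : Fin n →₀ ℕ}
    (h : EKAdmissible I F m ∧ F.card = q) (u : Fin n →₀ ℕ) (a : EKIdx I (q + 1))
    (ha : (monomial u (1 : k) • eEK I q F m) a ≠ 0) :
    a.1 = (F, m) ∧ (monomial u (1 : k) • eEK I q F m) a = monomial u 1 := by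
  classical
  rw [eEK_eq_single h, Finsupp.smul_single, smul_eq_mul, mul_one, Finsupp.single_apply] at ha ⊢
  split_ifs at ha ⊢ with h'
  · exact ⟨h' ▸ rfl, rfl⟩
  · exact absurd rfl ha

/-- A `k`-subspace contains `z` if it contains all monomial multiples of basis elements that
occur in `z`. -/
lemma mem_of_terms_mem {q : ℕ} (V : Submodule k (EK I (q + 1))) (z : EK I (q + 1))
    (h : ∀ (a : EKIdx I (q + 1)) (u : Fin n →₀ ℕ), coeff u (z a) ≠ 0 →
      monomial u (1 : k) • eEK I q a.1.1 a.1.2 ∈ V) : z ∈ V := by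
  rw [← Finsupp.sum_single z]
  refine Submodule.sum_mem _ fun a _ => ?_
  have : Finsupp.single a (z a) = ∑ u ∈ (z a).support,
      coeff u (z a) • monomial u (1 : k) • eEK I q a.1.1 a.1.2 := by
    conv_lhs => rw [(z a).as_sum]
    rw [← Finsupp.singleAddHom_apply, map_sum]
    refine Finset.sum_congr rfl fun u _ => ?_
    rw [← single_eq_eEK, Finsupp.smul_single, Finsupp.smul_single, smul_eq_mul, mul_one,
      smul_monomial, smul_eq_mul, mul_one, Finsupp.singleAddHom_apply]
  rw [this]
  exact Submodule.sum_mem _ fun u hu => V.smul_mem _ (h a u (mem_support_iff.mp hu))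

/-! ### Koszul matching and normal forms modulo boundaries -/

/-- The multiples `x^u e(F, m)` that are matched with elements of lower homological degree: the
smallest element of `F ∪ {f < ν(m) | x_f divides x^u}`, if there is one, is in `F`. -/
def Up (F : Finset (Fin n)) (m u : Fin n →₀ ℕ) : Prop :=
  ∀ f : Fin n, ps m (f + 1) < m.degree → u f ≠ 0 → ∃ i ∈ F, i ≤ f

/-- The variable that is moved to `F` in the matching of `x^u e(F, m)`. -/
def IsPivot (F : Finset (Fin n)) (m u : Fin n →₀ ℕ) (f : Fin n) : Prop :=
  ps m (f + 1) < m.degree ∧ u f ≠ 0 ∧ (∀ i ∈ F, f < i) ∧ ∀ l < f, u l = 0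

lemma IsPivot.unique {F : Finset (Fin n)} {m u : Fin n →₀ ℕ} {f f' : Fin n}
    (h : IsPivot F m u f) (h' : IsPivot F m u f') : f = f' := by
  by_contra hne
  rcases lt_or_gt_of_ne hne with hlt | hlt
  · exact h.2.1 (h'.2.2.2 f hlt)
  · exact h'.2.1 (h.2.2.2 f' hlt)

lemma IsPivot.not_up {F : Finset (Fin n)} {m u : Fin n →₀ ℕ} {f : Fin n}
    (h : IsPivot F m u f) : ¬ Up F m u := fun hu => by
  obtain ⟨i, hi, hif⟩ := hu f h.1 h.2.1
  exact absurd (h.2.2.1 i hi) (not_lt.mpr hif)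

lemma exists_isPivot {F : Finset (Fin n)} {m u : Fin n →₀ ℕ} (h : ¬ Up F m u) :
    ∃ f, IsPivot F m u f := by
  simp only [Up, not_forall, not_exists, not_and, not_le] at h
  obtain ⟨f₀, h1, h2, h3⟩ := h
  obtain ⟨f, hf, hmin⟩ := Finset.exists_min_image u.support (fun l => l)
    ⟨f₀, Finsupp.mem_support_iff.mpr h2⟩
  have hle : f ≤ f₀ := hmin f₀ (Finsupp.mem_support_iff.mpr h2)
  refine ⟨f, (ps_mono m ?_).trans_lt h1, Finsupp.mem_support_iff.mp hf,
    fun i hi => hle.trans_lt (h3 i hi), fun l hl => ?_⟩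
  · rw [Fin.le_def] at hle
    omega
  · by_contra hne
    exact absurd (hmin l (Finsupp.mem_support_iff.mpr hne)) (not_le.mpr hl)

/-- The span of the `x^u e(F, m)` with `Up F m u`. -/
def upSubmodule (I : Ideal (MvPolynomial (Fin n) k)) (q : ℕ) : Submodule k (EK I (q + 1)) where
  carrier := {z | ∀ a u, coeff u (z a) ≠ 0 → Up a.1.1 a.1.2 u}
  zero_mem' := fun a u h => absurd (by simp) h
  add_mem' := fun {x y} hx hy a u h => by
    rw [Finsupp.add_apply, coeff_add] at h
    by_cases h' : coeff u (x a) = 0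
    · rw [h', zero_add] at h
      exact hy a u h
    · exact hx a u h'
  smul_mem' := fun c x hx a u h => by
    rw [Finsupp.smul_apply, coeff_smul, smul_eq_mul] at h
    exact hx a u (right_ne_zero_of_mul h)

/-- The span of the `x^u e(F, m)` with `wt m < N`. -/
def wtSubmodule (I : Ideal (MvPolynomial (Fin n) k)) (q N : ℕ) : Submodule k (EK I (q + 1)) where
  carrier := {z | ∀ a : EKIdx I (q + 1), N ≤ wt a.1.2 → z a = 0}
  zero_mem' := fun _ _ => rfl
  add_mem' := fun hx hy a h => by rw [Finsupp.add_apply, hx a h, hy a h, add_zero]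
  smul_mem' := fun c x hx a h => by rw [Finsupp.smul_apply, hx a h, smul_zero]

lemma term_mem_upSubmodule {q : ℕ} {F : Finset (Fin n)} {m u : Fin n →₀ ℕ}
    (h : EKAdmissible I F m ∧ F.card = q) (hu : Up F m u) :
    monomial u (1 : k) • eEK I q F m ∈ upSubmodule I q := by
  classical
  intro a v hv
  obtain ⟨h1, h2⟩ := monomial_smul_eEK_apply h u a fun h0 => hv (by rw [h0, coeff_zero])
  rw [h2, coeff_monomial] at hv
  have : u = v := by
    by_contra hne
    exact hv (if_neg hne)
  rw [h1, ← this]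
  exact hu

lemma term_mem_wtSubmodule {q N : ℕ} {F : Finset (Fin n)} {m u : Fin n →₀ ℕ}
    (h : EKAdmissible I F m ∧ F.card = q) (hN : wt m < N) :
    monomial u (1 : k) • eEK I q F m ∈ wtSubmodule I q N := by
  intro a ha
  by_contra hne
  have := (monomial_smul_eEK_apply h u a hne).1
  rw [this] at ha
  exact absurd ha (not_le.mpr hN)

lemma wt_lt_of_coeff_ne_zero {q N : ℕ} {z : EK I (q + 1)} (hz : z ∈ wtSubmodule I q N)
    {a : EKIdx I (q + 1)} {u : Fin n →₀ ℕ} (h : coeff u (z a) ≠ 0) : wt a.1.2 < N := by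
  by_contra! hN
  exact h (by rw [hz a hN, coeff_zero])

lemma exists_mem_wtSubmodule {q : ℕ} (z : EK I (q + 1)) : ∃ N, z ∈ wtSubmodule I q N := by
  refine ⟨z.support.sup (fun a => wt a.1.2) + 1, fun a ha => ?_⟩
  by_contra hne
  have := Finset.le_sup (f := fun a : EKIdx I (q + 1) => wt a.1.2) (Finsupp.mem_support_iff.mpr hne)
  exact absurd (ha.trans this) (Nat.not_succ_le_self _)

lemma sg_smul {M : Type*} [AddCommGroup M] [Module k M] [Module (MvPolynomial (Fin n) k) M]
    (F : Finset (Fin n)) (i : Fin n) (z : M) :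
    sg k F i • z = ((-1) ^ (F.filter (fun j => j ≤ i)).card : k) • z := by
  rw [sg]
  rcases neg_one_pow_eq_or ℤ (F.filter (fun j => j ≤ i)).card with h | h
  · have h1 := congrArg (Int.cast : ℤ → k) h
    have h2 := congrArg (Int.cast : ℤ → MvPolynomial (Fin n) k) h
    push_cast at h1 h2
    rw [h1, h2, one_smul, one_smul]
  · have h1 := congrArg (Int.cast : ℤ → k) h
    have h2 := congrArg (Int.cast : ℤ → MvPolynomial (Fin n) k) h
    push_cast at h1 h2
    rw [h1, h2, neg_smul, neg_smul, one_smul, one_smul]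

lemma sg_eq_neg_one {F : Finset (Fin n)} {i : Fin n} (hi : i ∈ F) (hmin : ∀ j ∈ F, i ≤ j) :
    sg k F i = -1 := by
  have : F.filter (fun j => j ≤ i) = {i} := by
    ext j
    simp only [Finset.mem_filter, Finset.mem_singleton]
    exact ⟨fun h => le_antisymm h.2 (hmin j h.1), fun h => by rw [h]; exact ⟨hi, le_rfl⟩⟩
  rw [sg, this, Finset.card_singleton, pow_one]

/-- Modulo terms of lower weight, the `i`-th part of the differential is that of a Koszul
complex. -/
lemma monomial_smul_dterm_sub_mem (hI : IsBorelFixed I) {q : ℕ} {F : Finset (Fin n)}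
    {m : Fin n →₀ ℕ} (h : EKAdmissible I F m ∧ F.card = q + 1) {i : Fin n} (hi : i ∈ F)
    (u : Fin n →₀ ℕ) :
    monomial u (1 : k) • dterm I q F m i -
      monomial (u + Finsupp.single i 1) (1 : k) • eEK I q (F.erase i) m ∈
        wtSubmodule I q (wt m) := by
  have hc : (F.erase i).card = q := by rw [Finset.card_erase_of_mem hi, h.2]; rfl
  have hX : monomial u (1 : k) • (X i : MvPolynomial (Fin n) k) • eEK I q (F.erase i) m =
      monomial (u + Finsupp.single i 1) (1 : k) • eEK I q (F.erase i) m := by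
    rw [smul_smul, X, monomial_mul, one_mul]
  rw [dterm, smul_sub, hX, sub_sub_cancel_left]
  refine Submodule.neg_mem _ ?_
  split_ifs with hg
  · rw [smul_smul, monomial_mul, one_mul]
    exact term_mem_wtSubmodule ⟨h.1.erase_bracket hI hi hg, hc⟩
      (wt_bracket_lt hI h.1.1 (h.1.ps_lt hi))
  · rw [smul_zero]
    exact Submodule.zero_mem _

lemma sdiff_term {q : ℕ} {F : Finset (Fin n)} {m : Fin n →₀ ℕ}
    (h : EKAdmissible I F m ∧ F.card = q + 1) (u : Fin n →₀ ℕ) :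
    sdiff I (q + 1) (monomial u (1 : k) • eEK I (q + 1) F m) =
      ∑ i ∈ F, sg k F i • monomial u (1 : k) • dterm I q F m i := by
  rw [map_smul, sdiff_succ_eEK h, Finset.smul_sum]
  exact Finset.sum_congr rfl fun i _ => smul_comm _ _ _

/-- Removing a non-minimal `i` keeps `f` in the set, and `f` is still below every variable of the
new coefficient. -/
lemma up_erase {F : Finset (Fin n)} {m u : Fin n →₀ ℕ} {f i : Fin n} (hf : f ∈ F)
    (hmin : ∀ j ∈ F, f ≤ j) (hu : ∀ l < f, u l = 0) (hi : i ∈ F) (hif : i ≠ f) :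
    Up (F.erase i) m (u + Finsupp.single i 1) := by
  intro l _ hl
  refine ⟨f, Finset.mem_erase.mpr ⟨hif.symm, hf⟩, ?_⟩
  by_contra! hlt
  rw [Finsupp.add_apply, hu l hlt, zero_add, Finsupp.single_apply] at hl
  split_ifs at hl with h
  · exact absurd (hmin i hi) (not_le.mpr (h ▸ hlt))
  · exact hl rfl

/-- Induction on the weight. A term that is not `Up` is, up to sign, the leading term of the
boundary of its partner, in which the pivot has been moved into `F`. The other Koszul terms of that
boundary are `Up`, and the rest has smaller weight. -/
lemma wtSubmodule_le (hI : IsBorelFixed I) (q N : ℕ) : wtSubmodule I q N ≤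
    LinearMap.range ((sdiff I (q + 1)).restrictScalars k) ⊔ upSubmodule I q := by
  induction N with
  | zero =>
    intro z hz
    have : z = 0 := Finsupp.ext fun a => hz a (Nat.zero_le _)
    rw [this]
    exact Submodule.zero_mem _
  | succ N ih =>
    intro z hz
    refine mem_of_terms_mem _ z fun a u hau => ?_
    obtain ⟨⟨F, m⟩, h, hF⟩ := a
    have hwt : wt m < N + 1 := wt_lt_of_coeff_ne_zero hz hau
    simp only at h hF ⊢
    by_cases hup : Up F m u
    · exact Submodule.mem_sup_right (term_mem_upSubmodule ⟨h, hF⟩ hup)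
    obtain ⟨f, hf1, hf2, hf3, hf4⟩ := exists_isPivot hup
    have hfF : f ∉ F := fun hf => lt_irrefl _ (hf3 f hf)
    set F' := insert f F with hF'
    have hfF' : f ∈ F' := Finset.mem_insert_self _ _
    have hmin : ∀ j ∈ F', f ≤ j := by
      intro j hj
      rcases Finset.mem_insert.mp hj with rfl | hj
      · exact le_rfl
      · exact (hf3 j hj).le
    have hadm : EKAdmissible I F' m ∧ F'.card = q + 1 := by
      refine ⟨⟨h.1, fun i hi => ?_⟩, by rw [Finset.card_insert_of_notMem hfF, hF]⟩
      rcases Finset.mem_insert.mp hi with rfl | hi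
      · exact (lt_nu_iff m i).mpr hf1
      · exact h.2 i hi
    set u' := u - Finsupp.single f 1 with hu'
    have huu : u' + Finsupp.single f 1 = u := tsub_add_cancel_of_le (by
      rw [Finsupp.single_le_iff]; omega)
    have hu'0 : ∀ l < f, u' l = 0 := fun l hl => by
      rw [hu', Finsupp.tsub_apply, hf4 l hl, zero_tsub]
    have hrange : sdiff I (q + 1) (monomial u' (1 : k) • eEK I (q + 1) F' m) ∈
        LinearMap.range ((sdiff I (q + 1)).restrictScalars k) := ⟨_, rfl⟩
    have hlow : ∀ i ∈ F', monomial u' (1 : k) • dterm I q F' m i -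
        monomial (u' + Finsupp.single i 1) (1 : k) • eEK I q (F'.erase i) m ∈
        LinearMap.range ((sdiff I (q + 1)).restrictScalars k) ⊔ upSubmodule I q := by
      intro i hi
      refine ih fun a ha => monomial_smul_dterm_sub_mem hI hadm hi u' a ?_
      omega
    rw [sdiff_term hadm, ← Finset.add_sum_erase _ _ hfF', sg_eq_neg_one hfF' hmin, neg_smul,
      one_smul] at hrange
    have hrest : ∑ i ∈ F'.erase f, sg k F' i • monomial u' (1 : k) • dterm I q F' m i ∈
        LinearMap.range ((sdiff I (q + 1)).restrictScalars k) ⊔ upSubmodule I q := by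
      refine Submodule.sum_mem _ fun i hi => ?_
      obtain ⟨hif, hi⟩ := Finset.mem_erase.mp hi
      rw [sg_smul]
      refine Submodule.smul_mem _ _ ?_
      rw [← sub_add_cancel (monomial u' (1 : k) • dterm I q F' m i)
        (monomial (u' + Finsupp.single i 1) (1 : k) • eEK I q (F'.erase i) m)]
      refine Submodule.add_mem _ (hlow i hi) (Submodule.mem_sup_right ?_)
      exact term_mem_upSubmodule ⟨hadm.1.erase i, by
        rw [Finset.card_erase_of_mem hi, hadm.2]; rfl⟩ (up_erase hfF' hmin hu'0 hi hif)
    -- The boundary is solved for the term at the pivot `f`, which is the original term.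
    have h1 := hlow f hfF'
    rw [huu, Finset.erase_insert hfF] at h1
    have h2 := Submodule.sub_mem _ hrest (Submodule.mem_sup_left (T := upSubmodule I q) hrange)
    rw [sub_add_eq_sub_sub, sub_neg_eq_add, add_sub_cancel_left] at h2
    have h3 := Submodule.sub_mem _ h2 h1
    rwa [sub_sub_cancel] at h3

/-! ### Injectivity of the differential on normal forms -/

open Classical in
/-- The Koszul contraction on monomial multiples of basis elements. -/
def contractTerm (I : Ideal (MvPolynomial (Fin n) k)) (q : ℕ) (F : Finset (Fin n))
    (m u : Fin n →₀ ℕ) : EK I (q + 2) :=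
  if h : ∃ f, IsPivot F m u f then
    -(monomial (u - Finsupp.single h.choose 1) (1 : k) • eEK I (q + 1) (insert h.choose F) m)
  else 0

/-- The Koszul contraction. -/
def contract (I : Ideal (MvPolynomial (Fin n) k)) (q : ℕ) : EK I (q + 1) →ₗ[k] EK I (q + 2) :=
  Finsupp.lsum k fun a : EKIdx I (q + 1) =>
    (basisMonomials (Fin n) k).constr k (contractTerm I q a.1.1 a.1.2)

lemma contract_term {q : ℕ} {F : Finset (Fin n)} {m : Fin n →₀ ℕ}
    (h : EKAdmissible I F m ∧ F.card = q) (u : Fin n →₀ ℕ) :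
    contract I q (monomial u (1 : k) • eEK I q F m) = contractTerm I q F m u := by
  have hb : monomial u (1 : k) = basisMonomials (Fin n) k u := by rw [coe_basisMonomials]
  rw [contract, eEK_eq_single h, Finsupp.smul_single, smul_eq_mul, mul_one, Finsupp.lsum_single, hb,
    Module.Basis.constr_basis]

lemma contractTerm_of_up (q : ℕ) {F : Finset (Fin n)} {m u : Fin n →₀ ℕ} (h : Up F m u) :
    contractTerm I q F m u = 0 := by
  rw [contractTerm, dif_neg]
  rintro ⟨f, hf⟩
  exact hf.not_up h

lemma contractTerm_of_isPivot (q : ℕ) {F : Finset (Fin n)} {m u : Fin n →₀ ℕ} {f : Fin n}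
    (h : IsPivot F m u f) : contractTerm I q F m u =
      -(monomial (u - Finsupp.single f 1) (1 : k) • eEK I (q + 1) (insert f F) m) := by
  have hex : ∃ f, IsPivot F m u f := ⟨f, h⟩
  rw [contractTerm, dif_pos hex, hex.choose_spec.unique h]

lemma contract_mem_wtSubmodule {q N : ℕ} {z : EK I (q + 1)} (hz : z ∈ wtSubmodule I q N) :
    contract I q z ∈ wtSubmodule I (q + 1) N := by
  refine mem_of_terms_mem ((wtSubmodule I (q + 1) N).comap (contract I q)) z fun a u hau => ?_
  have hwt := wt_lt_of_coeff_ne_zero hz hau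
  rw [Submodule.mem_comap, contract_term a.2]
  by_cases hup : Up a.1.1 a.1.2 u
  · rw [contractTerm_of_up q hup]
    exact Submodule.zero_mem _
  · obtain ⟨f, hf⟩ := exists_isPivot hup
    rw [contractTerm_of_isPivot q hf]
    have hfF : f ∉ a.1.1 := fun h => lt_irrefl _ (hf.2.2.1 f h)
    refine Submodule.neg_mem _ (term_mem_wtSubmodule ⟨⟨a.2.1.1, fun i hi => ?_⟩, ?_⟩ hwt)
    · rcases Finset.mem_insert.mp hi with rfl | hi
      · exact (lt_nu_iff _ i).mpr hf.1
      · exact a.2.1.2 i hi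
    · rw [Finset.card_insert_of_notMem hfF, a.2.2]

/-- On `Up` terms the contraction inverts the Koszul differential from the left. Removing the
smallest index of `F` produces a term whose pivot is that index. Removing any other index produces
an `Up` term, which the contraction kills. Brackets only contribute lower weight. -/
lemma contract_sdiff_sub_mem (hI : IsBorelFixed I) {q N : ℕ} {z : EK I (q + 2)}
    (hz : z ∈ upSubmodule I (q + 1)) (hN : z ∈ wtSubmodule I (q + 1) (N + 1)) :
    contract I q (sdiff I (q + 1) z) - z ∈ wtSubmodule I (q + 1) N := by
  refine mem_of_terms_mem ((wtSubmodule I (q + 1) N).comap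
    (contract I q ∘ₗ (sdiff I (q + 1)).restrictScalars k - LinearMap.id)) z fun a u hau => ?_
  have hwt := wt_lt_of_coeff_ne_zero hN hau
  have hup : Up a.1.1 a.1.2 u := hz a u hau
  obtain ⟨⟨F, m⟩, h, hF⟩ := a
  simp only at h hF hwt hup ⊢
  obtain ⟨i, hi, hmin⟩ := Finset.exists_min_image F (fun l => l)
    (Finset.card_pos.mp (by omega))
  -- Indices below `min F` are also below `ν(m)`, so by `Up` the corresponding variables cannot
  -- divide `x^u`.
  have hu0 : ∀ l < i, u l = 0 := by
    intro l hl
    by_contra hne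
    have hlt := (ps_mono m (show l.val + 1 ≤ i.val + 1 by
      rw [Fin.lt_def] at hl; omega)).trans_lt (h.ps_lt hi)
    obtain ⟨j, hj, hjl⟩ := hup l hlt hne
    exact absurd (hmin j hj) (not_le.mpr (hjl.trans_lt hl))
  have hcard : ∀ l ∈ F, (F.erase l).card = q := fun l hl => by
    rw [Finset.card_erase_of_mem hl, hF]; rfl
  have hlow : ∀ l ∈ F, contract I q (monomial u (1 : k) • dterm I q F m l) -
      contract I q (monomial (u + Finsupp.single l 1) (1 : k) • eEK I q (F.erase l) m) ∈
        wtSubmodule I (q + 1) N := by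
    intro l hl
    rw [← map_sub]
    refine contract_mem_wtSubmodule fun a ha =>
      monomial_smul_dterm_sub_mem hI ⟨h, hF⟩ hl u a ?_
    omega
  rw [Submodule.mem_comap, LinearMap.sub_apply, LinearMap.comp_apply, LinearMap.id_apply,
    LinearMap.restrictScalars_apply, sdiff_term ⟨h, hF⟩, map_sum, ← Finset.add_sum_erase _ _ hi,
    sg_eq_neg_one hi hmin, neg_smul, one_smul, map_neg, add_sub_right_comm]
  refine Submodule.add_mem _ ?_ (Submodule.sum_mem _ fun l hl => ?_)
  · have h1 := hlow i hi
    have hpiv : IsPivot (F.erase i) m (u + Finsupp.single i 1) i := by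
      refine ⟨h.ps_lt hi, by simp, fun j hj => ?_, fun l hl => ?_⟩
      · obtain ⟨hji, hj⟩ := Finset.mem_erase.mp hj
        exact lt_of_le_of_ne (hmin j hj) hji.symm
      · rw [Finsupp.add_apply, hu0 l hl, zero_add, Finsupp.single_apply, if_neg hl.ne']
    rw [contract_term ⟨h.erase i, hcard i hi⟩, contractTerm_of_isPivot q hpiv,
      add_tsub_cancel_right, Finset.insert_erase hi, sub_neg_eq_add] at h1
    have h2 := Submodule.neg_mem _ h1
    rwa [neg_add'] at h2
  · obtain ⟨hli, hl⟩ := Finset.mem_erase.mp hl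
    rw [sg_smul, map_smul]
    refine Submodule.smul_mem _ _ ?_
    have h1 := hlow l hl
    rwa [contract_term ⟨h.erase l, hcard l hl⟩,
      contractTerm_of_up q (up_erase hi hmin hu0 hl hli), sub_zero] at h1

/-- For a cycle the contraction formula leaves `-z` in the next smaller weight step, so the weight
bound descends to zero. -/
lemma eq_zero_of_mem_upSubmodule_succ (hI : IsBorelFixed I) {q : ℕ} {z : EK I (q + 2)}
    (hz : z ∈ upSubmodule I (q + 1)) (h0 : sdiff I (q + 1) z = 0) : z = 0 := by
  obtain ⟨N, hN⟩ := exists_mem_wtSubmodule z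
  induction N with
  | zero => exact Finsupp.ext fun a => hN a (Nat.zero_le _)
  | succ N ih =>
    have := contract_sdiff_sub_mem hI hz hN
    rw [h0, map_zero, zero_sub, Submodule.neg_mem_iff] at this
    exact ih this

/-- The factorization `w = g(w) * (w / g(w))`, linearly extended. -/
def factor (I : Ideal (MvPolynomial (Fin n) k)) : EK I 0 →ₗ[k] EK I 1 :=
  Finsupp.lsum k fun _ : EKIdx I 0 =>
    (basisMonomials (Fin n) k).constr k fun w =>
      monomial (w - g I w) (1 : k) • eEK I 0 ∅ (g I w)

lemma factor_single (w : Fin n →₀ ℕ) :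
    factor I (Finsupp.single (show EKIdx I 0 from ()) (monomial w (1 : k))) =
      monomial (w - g I w) (1 : k) • eEK I 0 ∅ (g I w) := by
  have hb : monomial w (1 : k) = basisMonomials (Fin n) k w := by rw [coe_basisMonomials]
  rw [factor, Finsupp.lsum_single, hb, Module.Basis.constr_basis]

/-- For `F = ∅`, `Up` says that `x^u` contains no variable of index below `ν(m)`. Then `m` is the
leading factor of `x^u m`, and `factor` recovers the term from its image. -/
lemma eq_zero_of_mem_upSubmodule_zero (hI : IsBorelFixed I) {z : EK I 1}
    (hz : z ∈ upSubmodule I 0) (h0 : sdiff I 0 z = 0) : z = 0 := by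
  have key : z ∈ LinearMap.ker
      (factor I ∘ₗ (sdiff I 0).restrictScalars k - LinearMap.id) := by
    refine mem_of_terms_mem _ z fun a u hau => ?_
    have hup : Up a.1.1 a.1.2 u := hz a u hau
    obtain ⟨⟨F, m⟩, h, hF⟩ := a
    simp only at h hF hup ⊢
    obtain rfl := Finset.card_eq_zero.mp hF
    have hg : g I (u + m) = m := by
      refine g_eq_of_ps hI (mem_of_le le_add_self h.1.1) h.1 fun t => ?_
      rw [add_comm]
      refine ps_eq_min_of_add (fun i hi j hj => ?_) t
      by_contra! hlt
      obtain ⟨l, hl, -⟩ := hup j ((lt_nu_iff m j).mp ((lt_nu_iff_exists m j).mpr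
        ⟨i, hlt, Finsupp.mem_support_iff.mp hi⟩)) (Finsupp.mem_support_iff.mp hj)
      exact absurd hl (Finset.notMem_empty l)
    rw [LinearMap.mem_ker, LinearMap.sub_apply, LinearMap.comp_apply, LinearMap.id_apply,
      LinearMap.restrictScalars_apply, map_smul, sdiff_zero_eEK ⟨h, hF⟩, Finsupp.smul_single,
      smul_eq_mul, monomial_mul, one_mul, factor_single, hg, add_tsub_cancel_right, sub_self]
  rwa [LinearMap.mem_ker, LinearMap.sub_apply, LinearMap.comp_apply, LinearMap.id_apply,
    LinearMap.restrictScalars_apply, h0, map_zero, zero_sub, neg_eq_zero] at key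

lemma eq_zero_of_mem_upSubmodule (hI : IsBorelFixed I) : ∀ {q : ℕ} {z : EK I (q + 1)},
    z ∈ upSubmodule I q → sdiff I q z = 0 → z = 0
  | 0, _, hz, h0 => eq_zero_of_mem_upSubmodule_zero hI hz h0
  | _ + 1, _, hz, h0 => eq_zero_of_mem_upSubmodule_succ hI hz h0

theorem sdiff_exact (hI : IsBorelFixed I) (q : ℕ) :
    Function.Exact (sdiff I (q + 1)) (sdiff I q) := by
  intro z
  have hcomp : ∀ y, sdiff I q (sdiff I (q + 1) y) = 0 := fun y =>
    LinearMap.congr_fun (sdiff_comp_sdiff hI q) y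
  constructor
  · intro h0
    obtain ⟨N, hN⟩ := exists_mem_wtSubmodule z
    obtain ⟨y, hy, z', hz', rfl⟩ := Submodule.mem_sup.mp (wtSubmodule_le hI q N hN)
    obtain ⟨y, rfl⟩ := hy
    rw [map_add, LinearMap.restrictScalars_apply, hcomp, zero_add] at h0
    rw [eq_zero_of_mem_upSubmodule hI hz' h0, add_zero]
    exact ⟨y, rfl⟩
  · rintro ⟨y, rfl⟩
    exact hcomp y

theorem mem_range_sdiff_zero_iff (hI : IsBorelFixed I) (z : EK I 0) :
    z ∈ LinearMap.range (sdiff I 0) ↔ z (show EKIdx I 0 from ()) ∈ I := by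
  constructor
  · rintro ⟨y, rfl⟩
    have : LinearMap.range (sdiff I 0) ≤
        Submodule.comap (Finsupp.lapply (show EKIdx I 0 from ())) I := by
      rw [sdiff, Finsupp.range_linearCombination, Submodule.span_le]
      rintro _ ⟨a, rfl⟩
      rw [SetLike.mem_coe, Submodule.mem_comap, Finsupp.lapply_apply, Finsupp.single_eq_same]
      exact a.2.1.1.1
    exact this ⟨y, rfl⟩
  · intro hz
    have hz' : z = Finsupp.single (show EKIdx I 0 from ()) (z (show EKIdx I 0 from ())) :=
      Finsupp.ext fun a => (Finsupp.single_eq_same (a := a) (b := z a)).symm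
    rw [hz']
    generalize z (show EKIdx I 0 from ()) = p at hz
    rw [p.as_sum, ← Finsupp.singleAddHom_apply, map_sum]
    refine Submodule.sum_mem _ fun w hw => ?_
    have hwI := hI.1.mem_of_coeff_ne_zero hz (mem_support_iff.mp hw)
    refine ⟨monomial (w - g I w) (coeff w p) • eEK I 0 ∅ (g I w), ?_⟩
    rw [map_smul, sdiff_zero_eEK ⟨⟨g_mem_G hI hwI, by simp⟩, rfl⟩, Finsupp.smul_single, smul_eq_mul,
      monomial_mul, mul_one, tsub_add_cancel_of_le (g_le hI hwI), Finsupp.singleAddHom_apply]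

end Exactness

end

end BorelEK

namespace BorelEK

/-! ### Comparison of `P̃_• ⊗ S̃ / (Θ)` with the specialized complex -/

noncomputable section

section Comparison

variable {k : Type*} [Field k] {n d : ℕ} {I : Ideal (MvPolynomial (Fin n) k)}

lemma Admissible.injOn_fst {F : Finset (Fin n × Fin d)} {m : Fin n →₀ ℕ} (h : Admissible I F m) :
    Set.InjOn Prod.fst (F : Set (Fin n × Fin d)) := by
  intro p hp p' hp' hpp
  refine Prod.ext hpp (Fin.ext ?_)
  rw [h.snd_eq p hp, h.snd_eq p' hp', hpp]

lemma Admissible.ekAdmissible {F : Finset (Fin n × Fin d)} {m : Fin n →₀ ℕ}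
    (h : Admissible I F m) : EKAdmissible I (F.image Prod.fst) m := by
  refine ⟨h.mem, fun i hi => ?_⟩
  obtain ⟨p, hp, rfl⟩ := Finset.mem_image.mp hi
  exact h.lt_nu p hp

lemma Admissible.erase {F : Finset (Fin n × Fin d)} {m : Fin n →₀ ℕ}
    (h : Admissible I F m) (p : Fin n × Fin d) : Admissible I (F.erase p) m :=
  ⟨h.mem, fun p' hp' => h.lt_nu p' (Finset.mem_of_mem_erase hp'),
    fun p' hp' => h.snd_eq p' (Finset.mem_of_mem_erase hp')⟩

lemma Admissible.image_erase {F : Finset (Fin n × Fin d)} {m : Fin n →₀ ℕ}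
    (h : Admissible I F m) {p : Fin n × Fin d} (hp : p ∈ F) :
    (F.erase p).image Prod.fst = (F.image Prod.fst).erase p.1 := by
  ext i
  simp only [Finset.mem_image, Finset.mem_erase]
  constructor
  · rintro ⟨p', ⟨hne, hp'⟩, rfl⟩
    exact ⟨fun heq => hne (h.injOn_fst hp' hp heq), p', hp', rfl⟩
  · rintro ⟨hne, p', hp', rfl⟩
    exact ⟨p', ⟨fun heq => hne (heq ▸ rfl), hp'⟩, rfl⟩

lemma Admissible.pos_eq {F : Finset (Fin n × Fin d)} {m : Fin n →₀ ℕ}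
    (h : Admissible I F m) (p : Fin n × Fin d) :
    pos F p = ((F.image Prod.fst).filter (fun j => j ≤ p.1)).card := by
  rw [pos, Finset.filter_image, Finset.card_image_of_injOn]
  exact h.injOn_fst.mono fun p hp => (Finset.mem_filter.mp hp).1

/-- The column indices of `F̃` are partial sums of `m`. For the bracketed monomial to accept the
same cells, its partial sums at these rows must be the same. -/
lemma Admissible.erase_bracket_iff (hI : IsBorelFixed I) {F : Finset (Fin n × Fin d)}
    {m : Fin n →₀ ℕ} (h : Admissible I F m) {p : Fin n × Fin d} (hp : p ∈ F) :
    Admissible I (F.erase p) (bracket I m p.1) ↔ Good I (F.image Prod.fst) m p.1 := by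
  constructor
  · intro h' f hf hne
    obtain ⟨p', hp', rfl⟩ := Finset.mem_image.mp hf
    have hmem : p' ∈ F.erase p := Finset.mem_erase.mpr ⟨fun heq => hne (heq ▸ rfl), hp'⟩
    have h1 := h'.snd_eq p' hmem
    have h2 := h.snd_eq p' hp'
    have h3 := (lt_nu_iff _ _).mp (h'.lt_nu p' hmem)
    rw [sum_Iic_eq_ps] at h1 h2
    omega
  · intro hg
    refine ⟨bracket_mem_G hI h.mem ((lt_nu_iff _ _).mp (h.lt_nu p hp)), fun p' hp' => ?_,
      fun p' hp' => ?_⟩ <;>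
    obtain ⟨hne, hp'⟩ := Finset.mem_erase.mp hp' <;>
    have h1 := hg p'.1 (Finset.mem_image_of_mem _ hp')
      (fun heq => hne (h.injOn_fst hp' hp heq))
    · rw [lt_nu_iff]
      omega
    · rw [h.snd_eq p' hp', sum_Iic_eq_ps, sum_Iic_eq_ps, h1.1]

lemma corr_injective (q : ℕ) : Function.Injective (corr I d q) := by
  cases q with
  | zero => exact fun _ _ _ => rfl
  | succ q =>
    rintro ⟨⟨F, m⟩, h, hF⟩ ⟨⟨F', m'⟩, h', hF'⟩ heq
    have h1 : (F.image Prod.fst, m) = (F'.image Prod.fst, m') := congrArg Subtype.val heq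
    obtain ⟨h1', rfl⟩ := Prod.mk.inj h1
    have key : ∀ {F F' : Finset (Fin n × Fin d)}, Admissible I F m → Admissible I F' m →
        F.image Prod.fst = F'.image Prod.fst → F ⊆ F' := by
      intro F F' h h' h1 p hp
      have hp1 : p.1 ∈ F'.image Prod.fst := h1 ▸ Finset.mem_image_of_mem _ hp
      obtain ⟨p', hp', hpp⟩ := Finset.mem_image.mp hp1
      have : p = p' := Prod.ext hpp.symm
        (Fin.ext (by rw [h.snd_eq p hp, h'.snd_eq p' hp', hpp]))
      rwa [this]
    have h2 : F = F' := (key h h' h1').antisymm (key h' h h1'.symm)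
    subst h2
    rfl

lemma corr_surjective (hd : ∀ m ∈ G I, m.degree ≤ d) (q : ℕ) :
    Function.Surjective (corr I d q) := by
  cases q with
  | zero => exact fun _ => ⟨(), rfl⟩
  | succ q =>
    rintro ⟨⟨F, m⟩, h, hF⟩
    simp only at h hF
    -- With columns counted from zero, the required column is `ps m (i + 1)`. It exists because this
    -- partial sum is smaller than the degree of a generator, which is at most `d`.
    have hlt : ∀ i ∈ F, ps m (i + 1) < d := fun i hi => (h.ps_lt hi).trans_le (hd m h.1)
    let lift : F → Fin n × Fin d := fun i => (i.1, ⟨ps m (i.1 + 1), hlt i.1 i.2⟩)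
    have himg : (F.attach.image lift).image Prod.fst = F := by
      rw [Finset.image_image]
      exact Finset.attach_image_val
    have hcard : (F.attach.image lift).card = q := by
      rw [Finset.card_image_of_injective, Finset.card_attach, hF]
      intro i j hij
      exact Subtype.ext (congrArg Prod.fst hij)
    have hadm : Admissible I (F.attach.image lift) m := by
      refine ⟨h.1, fun p hp => ?_, fun p hp => ?_⟩ <;>
      obtain ⟨i, -, rfl⟩ := Finset.mem_image.mp hp
      · exact h.2 i.1 i.2
      · rw [sum_Iic_eq_ps]
    exact ⟨⟨(F.attach.image lift, m), hadm, hcard⟩, Subtype.ext (Prod.ext himg rfl)⟩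

lemma sum_Iio_eq_ps (m : Fin n →₀ ℕ) (i : Fin n) : ∑ l ∈ Finset.Iio i, m l = ps m i := by
  refine Finset.sum_congr (Finset.ext fun l => ?_) fun _ _ => rfl
  rw [Finset.mem_Iio, Finset.mem_filter, Fin.lt_def]
  exact (and_iff_right (Finset.mem_univ l)).symm

lemma bpol_apply (m : Fin n →₀ ℕ) (p : Fin n × Fin d) :
    bpol d m p = if ps m p.1 ≤ p.2 ∧ (p.2 : ℕ) < ps m (p.1 + 1) then 1 else 0 := by
  rw [bpol, Finsupp.equivFunOnFinite_symm_apply_apply, sum_Iic_eq_ps, sum_Iio_eq_ps]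

/-- The row of `x_i` occupies the columns from `ps m i` up to, but excluding, `ps m (i + 1)`. The
degree bound ensures that none of them falls outside the `d` available ones. -/
lemma mapDomain_fst_bpol {m : Fin n →₀ ℕ} (hm : m.degree ≤ d) :
    (bpol d m).mapDomain Prod.fst = m := by
  classical
  ext i
  rw [Finsupp.mapDomain, Finsupp.sum_apply, Finsupp.sum_fintype _ _ (fun _ => by simp),
    Fintype.sum_prod_type, Finset.sum_eq_single i
      (fun j _ hj => Finset.sum_eq_zero fun _ _ => Finsupp.single_eq_of_ne hj.symm)
      (fun h => absurd (Finset.mem_univ i) h)]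
  simp only [Finsupp.single_eq_same, bpol_apply]
  have h1 := ps_succ m i
  have h2 := ps_le_degree m (i + 1)
  rw [Fin.sum_univ_eq_sum_range (fun j => if ps m i ≤ j ∧ j < ps m (i + 1) then 1 else 0),
    Finset.sum_boole, Nat.cast_id]
  have : (Finset.range d).filter (fun j => ps m i ≤ j ∧ j < ps m (i + 1)) =
      Finset.Ico (ps m i) (ps m (i + 1)) := by
    ext j
    simp only [Finset.mem_filter, Finset.mem_range, Finset.mem_Ico]
    omega
  rw [this, Nat.card_Ico]
  omega

/-- The quotient in the differential of `P̃_•` is thus a genuine monomial. Rows below `i` may only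
be cut short. Row `i` may gain exactly the cell `p`, whose column is the first free one. Later rows
start no earlier and end no later, or become empty. -/
lemma bpol_bracket_le (hI : IsBorelFixed I) {m : Fin n →₀ ℕ} (hm : m ∈ G I)
    {p : Fin n × Fin d} (hp : (p.1 : WithBot (Fin n)) < nu m)
    (hp2 : (p.2 : ℕ) = ∑ l ∈ Finset.Iic p.1, m l) :
    bpol d (bracket I m p.1) ≤ Finsupp.single p 1 + bpol d m := by
  classical
  obtain ⟨i, j⟩ := p
  have hi := (lt_nu_iff _ _).mp hp
  rw [sum_Iic_eq_ps] at hp2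
  rintro ⟨f, l⟩
  rw [Finsupp.add_apply, bpol_apply, bpol_apply, ps_bracket hI hm hi, ps_bracket hI hm hi,
    Finsupp.single_apply]
  simp only [Prod.mk.injEq, Fin.ext_iff] at hi hp2 ⊢
  rcases lt_trichotomy f.val i.val with h | h | h
  · rw [if_neg (by omega : ¬ i.val < f.val), if_neg (by omega : ¬ i.val < f.val + 1)]
    split_ifs <;> omega
  · have hfi : f = i := Fin.ext h
    subst hfi
    rw [if_neg (by omega : ¬ f.val < f.val), if_pos (by omega : f.val < f.val + 1)]
    split_ifs <;> omega
  · have := ps_mono m (show i.val + 1 ≤ f.val by omega)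
    rw [if_pos h, if_pos (by omega : i.val < f.val + 1)]
    split_ifs <;> omega

lemma rename_pow_mul (N : ℕ) (s : MvPolynomial (Fin n × Fin d) k) :
    rename Prod.fst ((-1) ^ N * s) = (-1) ^ N * rename Prod.fst s := by
  rw [map_mul, map_pow, map_neg, map_one]

lemma sdiff_zero_single (a : EKIdx I 1) : sdiff I 0 (Finsupp.single a 1) =
    Finsupp.single (show EKIdx I 0 from ()) (monomial a.1.2 (1 : k)) := by
  rw [single_eq_eEK, sdiff_zero_eEK a.2]

lemma monomial_mem_maximal {u : Fin n →₀ ℕ} (hu : u ≠ 0) :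
    monomial u (1 : k) ∈ Ideal.span (Set.range (X : Fin n → MvPolynomial (Fin n) k)) := by
  obtain ⟨i, hi⟩ := Finsupp.ne_iff.mp hu
  rw [Finsupp.coe_zero, Pi.zero_apply] at hi
  have : Finsupp.single i 1 ≤ u := by rw [Finsupp.single_le_iff]; omega
  exact mem_of_le this (Ideal.subset_span ⟨i, rfl⟩)

lemma ne_zero_of_mem_G (htop : I ≠ ⊤) {m : Fin n →₀ ℕ} (hm : m ∈ G I) : m ≠ 0 := by
  rintro rfl
  exact htop ((Ideal.eq_top_iff_one I).mpr hm.1)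

lemma range_sdiff_le (hI : IsBorelFixed I) (htop : I ≠ ⊤) (q : ℕ) :
    LinearMap.range (sdiff I q) ≤ Ideal.span (Set.range (X : Fin n → MvPolynomial (Fin n) k)) •
      (⊤ : Submodule _ (EK I q)) := by
  rw [LinearMap.range_eq_map, Submodule.map_le_iff_le_comap]
  intro z _
  rw [← Finsupp.sum_single z]
  refine Submodule.sum_mem _ fun a _ => ?_
  rw [← mul_one (z a), ← smul_eq_mul, ← Finsupp.smul_single]
  refine Submodule.smul_mem _ _ ?_
  rw [Submodule.mem_comap]
  cases q with
  | zero =>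
    rw [sdiff_zero_single, ← mul_one (monomial _ _), ← smul_eq_mul, ← Finsupp.smul_single]
    exact Submodule.smul_mem_smul (monomial_mem_maximal (ne_zero_of_mem_G htop a.2.1.1)) trivial
  | succ q =>
    rw [single_eq_eEK, sdiff_succ_eEK a.2]
    refine Submodule.sum_mem _ fun i hi => Submodule.smul_mem _ _ (Submodule.sub_mem _ ?_ ?_)
    · exact Submodule.smul_mem_smul (Ideal.subset_span ⟨i, rfl⟩) trivial
    · split_ifs
      -- A unit coefficient would force `x_i m` to divide `m_⟨i⟩`, whose degree is at most that of
      -- `m`.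
      · refine Submodule.smul_mem_smul (monomial_mem_maximal fun h0 => ?_) trivial
        have hlt := a.2.1.ps_lt hi
        have h1 := Finsupp.degree_mono (tsub_eq_zero_iff_le.mp h0)
        have h2 := bracket_degree_le hI a.2.1.1 hlt
        rw [map_add, Finsupp.degree_single] at h1
        omega
      · exact Submodule.zero_mem _

/-- The multidegrees of the basis elements of the specialized complex. -/
def ekdeg (I : Ideal (MvPolynomial (Fin n) k)) : (q : ℕ) → EKIdx I q → (Fin n →₀ ℕ)
  | 0, _ => 0
  | _ + 1, a => a.1.2 + ∑ i ∈ a.1.1, Finsupp.single i 1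

lemma mdeg_eq (q : ℕ) (a : Idx I d q) : mdeg I d q a = ekdeg I q (corr I d q a) := by
  cases q with
  | zero => rfl
  | succ q =>
    change _ = a.1.2 + ∑ i ∈ a.1.1.image Prod.fst, Finsupp.single i 1
    rw [Finset.sum_image a.2.1.injOn_fst]
    rfl

/-- The elements that are homogeneous of multidegree `w`. -/
def homogSubmodule (I : Ideal (MvPolynomial (Fin n) k)) (q : ℕ) (w : Fin n →₀ ℕ) :
    Submodule k (EK I q) where
  carrier := {z | ∀ a c, coeff c (z a) ≠ 0 → c + ekdeg I q a = w}
  zero_mem' := fun a u h => absurd (by simp) h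
  add_mem' := fun {x y} hx hy a u h => by
    rw [Finsupp.add_apply, coeff_add] at h
    by_cases h' : coeff u (x a) = 0
    · rw [h', zero_add] at h
      exact hy a u h
    · exact hx a u h'
  smul_mem' := fun c x hx a u h => by
    rw [Finsupp.smul_apply, coeff_smul, smul_eq_mul] at h
    exact hx a u (right_ne_zero_of_mul h)

lemma single_mem_homogSubmodule {q : ℕ} (a : EKIdx I q) (u w : Fin n →₀ ℕ)
    (h : u + ekdeg I q a = w) :
    Finsupp.single a (monomial u (1 : k)) ∈ homogSubmodule I q w := by
  classical
  intro b c hc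
  rw [Finsupp.single_apply] at hc
  split_ifs at hc with hab
  · rw [coeff_monomial] at hc
    have huc : u = c := by
      by_contra hne
      exact hc (if_neg hne)
    rw [← huc, ← hab, h]
  · exact absurd (coeff_zero _) hc

lemma term_mem_homogSubmodule {q : ℕ} {F : Finset (Fin n)} {m u w : Fin n →₀ ℕ}
    (h : EKAdmissible I F m ∧ F.card = q) (hw : u + (m + ∑ i ∈ F, Finsupp.single i 1) = w) :
    monomial u (1 : k) • eEK I q F m ∈ homogSubmodule I (q + 1) w := by
  rw [eEK_eq_single h, Finsupp.smul_single, smul_eq_mul, mul_one]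
  exact single_mem_homogSubmodule _ _ _ hw

lemma sdiff_single_mem_homogSubmodule (hI : IsBorelFixed I) (q : ℕ) (a : EKIdx I (q + 1)) :
    sdiff I q (Finsupp.single a 1) ∈ homogSubmodule I q (ekdeg I (q + 1) a) := by
  cases q with
  | zero =>
    rw [sdiff_zero_single]
    refine single_mem_homogSubmodule _ _ _ ?_
    change a.1.2 + 0 = a.1.2 + ∑ i ∈ a.1.1, Finsupp.single i 1
    rw [Finset.card_eq_zero.mp a.2.2, Finset.sum_empty]
  | succ q =>
    rw [single_eq_eEK, sdiff_succ_eEK a.2]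
    change _ ∈ homogSubmodule I (q + 1) (a.1.2 + ∑ i ∈ a.1.1, Finsupp.single i 1)
    obtain ⟨⟨F, m⟩, h, hF⟩ := a
    simp only at h hF ⊢
    refine Submodule.sum_mem _ fun i hi => ?_
    have hc : (F.erase i).card = q := by rw [Finset.card_erase_of_mem hi, hF]; rfl
    have hsum := Finset.add_sum_erase F (fun i => Finsupp.single i 1) hi
    rw [sg_smul]
    refine Submodule.smul_mem _ _ (Submodule.sub_mem _ ?_ ?_)
    · rw [X]
      refine term_mem_homogSubmodule ⟨h.erase i, hc⟩ ?_
      rw [add_left_comm, hsum]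
    · split_ifs with hg
      · refine term_mem_homogSubmodule ⟨h.erase_bracket hI hi hg, hc⟩ ?_
        rw [← add_assoc, tsub_add_cancel_of_le (bracket_le hI h.1 (h.ps_lt hi)), add_right_comm,
          hsum, add_comm]
      · exact Submodule.zero_mem _

lemma finite_idx (hd : ∀ m ∈ G I, m.degree ≤ d) (q : ℕ) : Finite (Idx I d q) := by
  cases q with
  | zero => exact inferInstanceAs (Finite Unit)
  | succ q =>
    have hfin := Finsupp.finite_of_degree_le (σ := Fin n) d
    have : Finite {m : Fin n →₀ ℕ // m.degree ≤ d} := hfin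
    refine Finite.of_injective (β := Finset (Fin n × Fin d) × {m : Fin n →₀ ℕ // m.degree ≤ d})
      (fun a => (a.1.1, ⟨a.1.2, hd _ a.2.1.mem⟩)) fun a b hab => ?_
    obtain ⟨h1, h2⟩ := Prod.mk.inj hab
    exact Subtype.ext (Prod.ext h1 (Subtype.mk.inj h2))

variable [NeZero d]

lemma quotThetaEquiv_mk (s : MvPolynomial (Fin n × Fin d) k) :
    quotThetaEquiv k n d (Ideal.Quotient.mk _ s) = rename Prod.fst s := by
  have : (aeval fun p : Fin n × Fin d => (X p.1 : MvPolynomial (Fin n) k)) =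
      rename Prod.fst := by
    apply MvPolynomial.algHom_ext
    intro p
    rw [aeval_X, rename_X]
  rw [← this]
  rfl

/-- The map `x ↦ 1 ⊗ x` to `P̃_q ⊗ S̃ / (Θ)`. -/
def toTP (I : Ideal (MvPolynomial (Fin n) k)) (d : ℕ) [NeZero d] (q : ℕ) : P I d q →+ TP I d q :=
  (TensorProduct.mk (MvPolynomial (Fin n × Fin d) k) (QuotTheta k n d) (P I d q) 1).toAddMonoidHom

/-- `toTP` is semilinear along `x_{i,j} ↦ x_i`; this is how coefficients of `diff` specialize. -/
lemma toTP_smul (q : ℕ) (s : MvPolynomial (Fin n × Fin d) k) (x : P I d q) :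
    toTP I d q (s • x) = rename Prod.fst s • toTP I d q x := by
  have h1 : (rename Prod.fst s : MvPolynomial (Fin n) k) • toTP I d q x =
      ((quotThetaEquiv k n d).symm (rename Prod.fst s)) • toTP I d q x := rfl
  rw [h1, ← quotThetaEquiv_mk, AlgEquiv.symm_apply_apply]
  change (1 : QuotTheta k n d) ⊗ₜ[MvPolynomial (Fin n × Fin d) k] (s • x) =
    (Ideal.Quotient.mk (Ideal.span (Theta k n d)) s) •
      ((1 : QuotTheta k n d) ⊗ₜ[MvPolynomial (Fin n × Fin d) k] x)
  rw [TensorProduct.tmul_smul, TensorProduct.smul_tmul', TensorProduct.smul_tmul']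
  rfl

lemma tbasis_apply (q : ℕ) (a : Idx I d q) :
    tbasis I d q a = toTP I d q (Finsupp.single a 1) := by
  rw [tbasis, Module.Basis.mapCoeffs_apply]
  refine (Module.Basis.baseChange_apply _ _ _).trans ?_
  rw [Finsupp.coe_basisSingleOne]
  rfl

lemma tdiff_toTP (q : ℕ) (x : P I d (q + 1)) :
    tdiff I d q (toTP I d (q + 1) x) = toTP I d q (diff I d q x) :=
  LinearMap.baseChange_tmul _ _ _

lemma corrMap_toTP_single (q : ℕ) (a : Idx I d q) :
    corrMap I d q (toTP I d q (Finsupp.single a 1)) = Finsupp.single (corr I d q a) 1 := by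
  rw [← tbasis_apply, corrMap, Module.Basis.constr_basis]

lemma corrMap_toTP_e {q : ℕ} {F : Finset (Fin n × Fin d)} {m : Fin n →₀ ℕ}
    (h : Admissible I F m ∧ F.card = q) :
    corrMap I d (q + 1) (toTP I d (q + 1) (e I q F m)) = eEK I q (F.image Prod.fst) m := by
  rw [e, dif_pos h, corrMap_toTP_single, eEK_eq_single
    ⟨h.1.ekAdmissible, by rw [Finset.card_image_of_injOn h.1.injOn_fst, h.2]⟩]
  rfl

lemma corrMap_tdiff_basis (hI : IsBorelFixed I) (hd : ∀ m ∈ G I, m.degree ≤ d) (q : ℕ)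
    (a : Idx I d (q + 1)) :
    corrMap I d q (tdiff I d q (tbasis I d (q + 1) a)) =
      sdiff I q (Finsupp.single (corr I d (q + 1) a) 1) := by
  classical
  rw [tbasis_apply, tdiff_toTP]
  cases q with
  | zero =>
    have h1 : diff I d 0 (Finsupp.single a 1) = monomial (bpol d a.1.2) (1 : k) •
        Finsupp.single (show Idx I d 0 from ()) 1 := by
      rw [Finsupp.smul_single, smul_eq_mul, mul_one, diff]
      exact (Finsupp.linearCombination_single _ _ _).trans (one_smul _ _)
    rw [h1, toTP_smul, map_smul, corrMap_toTP_single, rename_monomial,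
      mapDomain_fst_bpol (hd _ a.2.1.mem), single_eq_eEK, sdiff_zero_eEK (corr I d 1 a).2,
      Finsupp.smul_single, smul_eq_mul, mul_one]
    rfl
  | succ q =>
    obtain ⟨⟨F, m⟩, h, hF⟩ := a
    simp only at h hF
    have hc : (F.image Prod.fst).card = q + 1 := by
      rw [Finset.card_image_of_injOn h.injOn_fst, hF]
    have hce : ∀ p ∈ F, (F.erase p).card = q := fun p hp => by
      rw [Finset.card_erase_of_mem hp, hF]; rfl
    have h1 : diff I d (q + 1) (Finsupp.single (show Idx I d (q + 2) from ⟨(F, m), h, hF⟩) 1) =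
      ∑ p ∈ F, ((-1) ^ pos F p * X p : MvPolynomial (Fin n × Fin d) k) • e I q (F.erase p) m
      - ∑ p ∈ F.filter (fun p => Admissible I (F.erase p) (bracket I m p.1)),
          ((-1) ^ pos F p *
            monomial (Finsupp.single p 1 + bpol d m - bpol d (bracket I m p.1)) (1 : k)) •
          e I q (F.erase p) (bracket I m p.1) := by
      rw [diff]
      exact (Finsupp.linearCombination_single _ _ _).trans (one_smul _ _)
    have h2 : sdiff I (q + 1) (Finsupp.single
        (corr I d (q + 2) (show Idx I d (q + 2) from ⟨(F, m), h, hF⟩)) 1) =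
        ∑ i ∈ F.image Prod.fst, sg k (F.image Prod.fst) i • dterm I q (F.image Prod.fst) m i := by
      rw [single_eq_eEK, ← sdiff_succ_eEK ⟨h.ekAdmissible, hc⟩]
      rfl
    refine Eq.trans ?_ h2.symm
    refine (congrArg (fun x => corrMap I d (q + 1) (toTP I d (q + 1) x)) h1).trans ?_
    rw [Finset.sum_filter, ← Finset.sum_sub_distrib, map_sum, map_sum,
      Finset.sum_image h.injOn_fst]
    refine Finset.sum_congr rfl fun p hp => ?_
    have hadm := h.erase_bracket_iff hI hp
    rw [map_sub, map_sub, toTP_smul, map_smul, corrMap_toTP_e ⟨h.erase p, hce p hp⟩,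
      rename_pow_mul, rename_X, h.image_erase hp, mul_smul, sg, dterm, smul_sub, h.pos_eq]
    congr 1
    by_cases hg : Good I (F.image Prod.fst) m p.1
    · have hlt := (lt_nu_iff _ _).mp (h.lt_nu p hp)
      have hmap : (Finsupp.single p 1 + bpol d m - bpol d (bracket I m p.1)).mapDomain Prod.fst =
          Finsupp.single p.1 1 + m - bracket I m p.1 := by
        -- Specialization respects this truncated subtraction because the polarized divisibility
        -- makes it exact.
        refine eq_tsub_of_add_eq ?_
        conv_lhs => arg 2; rw [← mapDomain_fst_bpol (hd _ (bracket_mem_G hI h.mem hlt))]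
        rw [← Finsupp.mapDomain_add,
          tsub_add_cancel_of_le (bpol_bracket_le hI h.mem (h.lt_nu p hp) (h.snd_eq p hp)),
          Finsupp.mapDomain_add, mapDomain_fst_bpol (hd _ h.mem), Finsupp.mapDomain_single]
      rw [if_pos hg, if_pos (hadm.mpr hg), toTP_smul, map_smul,
        corrMap_toTP_e ⟨hadm.mpr hg, hce p hp⟩, rename_pow_mul, rename_monomial, hmap,
        h.image_erase hp, mul_smul]
    · rw [if_neg hg, if_neg (fun h' => hg (hadm.mp h')), map_zero, map_zero, smul_zero]

lemma corrMap_tdiff (hI : IsBorelFixed I) (hd : ∀ m ∈ G I, m.degree ≤ d) (q : ℕ)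
    (z : TP I d (q + 1)) :
    corrMap I d q (tdiff I d q z) = sdiff I q (corrMap I d (q + 1) z) := by
  have : corrMap I d q ∘ₗ tdiff I d q = sdiff I q ∘ₗ corrMap I d (q + 1) := by
    refine (tbasis I d (q + 1)).ext fun a => ?_
    rw [LinearMap.comp_apply, LinearMap.comp_apply, corrMap_tdiff_basis hI hd q a]
    congr 1
    rw [tbasis_apply, corrMap_toTP_single]
  exact LinearMap.congr_fun this z

/-- `corrMap` as an isomorphism. -/
def corrEquiv (hd : ∀ m ∈ G I, m.degree ≤ d) (q : ℕ) :
    TP I d q ≃ₗ[MvPolynomial (Fin n) k] EK I q :=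
  (tbasis I d q).equiv (Finsupp.basisSingleOne (R := MvPolynomial (Fin n) k) (ι := EKIdx I q))
    (Equiv.ofBijective (corr I d q) ⟨corr_injective q, corr_surjective hd q⟩)

lemma corrEquiv_apply (hd : ∀ m ∈ G I, m.degree ≤ d) (q : ℕ) (z : TP I d q) :
    corrEquiv hd q z = corrMap I d q z := by
  have : (corrEquiv hd q).toLinearMap = corrMap I d q := by
    refine (tbasis I d q).ext fun a => ?_
    rw [LinearEquiv.coe_coe, corrEquiv, Module.Basis.equiv_apply, Finsupp.coe_basisSingleOne,
      tbasis_apply, corrMap_toTP_single]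
    rfl
  exact LinearMap.congr_fun this z

lemma corrMap_apply_corr (q : ℕ) (z : TP I d q) (j : Idx I d q) :
    corrMap I d q z (corr I d q j) = (tbasis I d q).repr z j := by
  classical
  have : Finsupp.lapply (corr I d q j) ∘ₗ corrMap I d q =
      Finsupp.lapply j ∘ₗ (tbasis I d q).repr.toLinearMap := by
    refine (tbasis I d q).ext fun a => ?_
    rw [LinearMap.comp_apply, LinearMap.comp_apply, LinearEquiv.coe_coe, Module.Basis.repr_self,
      tbasis_apply, corrMap_toTP_single, Finsupp.lapply_apply, Finsupp.lapply_apply,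
      Finsupp.single_apply, Finsupp.single_apply, (corr_injective q).eq_iff]
  exact LinearMap.congr_fun this z

lemma augmentation_eq (z : TP I d 0) :
    augmentation I d z = Ideal.Quotient.mk I (corrMap I d 0 z (show EKIdx I 0 from ())) := by
  have : augmentation I d = (Submodule.mkQ I) ∘ₗ
      Finsupp.lapply (show EKIdx I 0 from ()) ∘ₗ corrMap I d 0 := by
    refine (tbasis I d 0).ext fun a => ?_
    rw [LinearMap.comp_apply, LinearMap.comp_apply, Finsupp.lapply_apply, augmentation,
      Module.Basis.constr_basis, tbasis_apply, corrMap_toTP_single]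
    have : (Finsupp.single (corr I d 0 a) (1 : MvPolynomial (Fin n) k))
        (show EKIdx I 0 from ()) = 1 := Finsupp.single_eq_same
    rw [this]
    rfl
  rw [this]
  rfl

theorem isMinimalFreeResolution (hI : IsBorelFixed I) (htop : I ≠ ⊤)
    (hd : ∀ m ∈ G I, m.degree ≤ d) :
    IsMinimalFreeResolution (C := TP I d) (tdiff I d) (augmentation I d) where
  free q := Module.Free.of_basis (tbasis I d q)
  finite q := by
    have := finite_idx hd q
    exact Module.Finite.of_basis (tbasis I d q)
  exact q z := by
    have hinj := (corrEquiv hd q).injective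
    have hinj' := (corrEquiv hd (q + 1)).injective
    have h := sdiff_exact hI q (corrMap I d (q + 1) z)
    rw [← corrMap_tdiff hI hd, ← corrEquiv_apply hd, map_eq_zero_iff _ hinj] at h
    rw [h]
    constructor
    · rintro ⟨y, hy⟩
      refine ⟨(corrEquiv hd (q + 2)).symm y, hinj' ?_⟩
      rw [corrEquiv_apply, corrMap_tdiff hI hd, ← corrEquiv_apply hd, LinearEquiv.apply_symm_apply,
        hy, corrEquiv_apply]
    · rintro ⟨y, rfl⟩
      exact ⟨corrMap I d (q + 2) y, (corrMap_tdiff hI hd (q + 1) y).symm⟩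
  exact_zero z := by
    rw [augmentation_eq, Ideal.Quotient.eq_zero_iff_mem, ← mem_range_sdiff_zero_iff hI]
    constructor
    · rintro ⟨y, hy⟩
      refine ⟨(corrEquiv hd 1).symm y, (corrEquiv hd 0).injective ?_⟩
      rw [corrEquiv_apply, corrMap_tdiff hI hd, ← corrEquiv_apply hd, LinearEquiv.apply_symm_apply,
        hy, corrEquiv_apply]
    · rintro ⟨y, rfl⟩
      exact ⟨corrMap I d 1 y, (corrMap_tdiff hI hd 0 y).symm⟩
  surjective y := by
    obtain ⟨s, rfl⟩ := Ideal.Quotient.mk_surjective y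
    refine ⟨s • tbasis I d 0 (show Idx I d 0 from ()), ?_⟩
    rw [map_smul, augmentation, Module.Basis.constr_basis]
    exact congrArg (Ideal.Quotient.mk I) (mul_one s)
  minimal q := by
    rintro _ ⟨z, rfl⟩
    have h1 : tdiff I d q z = (corrEquiv hd q).symm (sdiff I q (corrMap I d (q + 1) z)) := by
      rw [LinearEquiv.eq_symm_apply, corrEquiv_apply, corrMap_tdiff hI hd]
    rw [h1]
    -- The bound on the image is transported back along the inverse isomorphism, which maps `𝔪 • ⊤`
    -- into `𝔪 • ⊤`.
    have h2 := Submodule.mem_map_of_mem (f := (corrEquiv hd q).symm.toLinearMap)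
      (range_sdiff_le hI htop q ⟨corrMap I d (q + 1) z, rfl⟩)
    rw [Submodule.map_smul''] at h2
    exact Submodule.smul_mono le_rfl le_top h2

theorem isMultigraded (hI : IsBorelFixed I) (hd : ∀ m ∈ G I, m.degree ≤ d) :
    IsMultigraded (C := TP I d) (tdiff I d) (tbasis I d) (mdeg I d) := by
  intro q a j c hc
  rw [← corrMap_apply_corr, corrMap_tdiff_basis hI hd] at hc
  rw [mdeg_eq, mdeg_eq]
  exact sdiff_single_mem_homogSubmodule hI q _ _ c (mem_support_iff.mp hc)

end Comparison

end

end BorelEK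

namespace BorelEK

/-! ### Counting the terms of a differential -/

noncomputable section

section Support

lemma support_sum_single {ι α M : Type*} [DecidableEq α] [AddCommMonoid M] {s : Finset ι}
    {f : ι → α} {c : ι → M} (hf : Set.InjOn f s) (hc : ∀ x ∈ s, c x ≠ 0) :
    (∑ x ∈ s, Finsupp.single (f x) (c x)).support = s.image f := by
  classical
  induction s using Finset.induction_on with
  | empty => simp
  | insert a s ha ih =>
    have ih' := ih (hf.mono (by simp)) fun x hx => hc x (Finset.mem_insert_of_mem hx)
    have h1 := Finsupp.support_single (a := f a) (hc a (Finset.mem_insert_self a s))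
    have hfa : f a ∉ s.image f := by
      intro h
      obtain ⟨x, hx, hxa⟩ := Finset.mem_image.mp h
      exact ha (hf (by simp [hx]) (by simp) hxa ▸ hx)
    rw [Finset.sum_insert ha, Finsupp.support_add_eq, h1, ih', Finset.image_insert,
      Finset.insert_eq]
    rwa [h1, ih', Finset.disjoint_singleton_left]

variable {k : Type*} [Field k] {n : ℕ} {I : Ideal (MvPolynomial (Fin n) k)}

lemma mapDomain_smul_eEK {q : ℕ} {F : Finset (Fin n)} {m : Fin n →₀ ℕ}
    (h : EKAdmissible I F m ∧ F.card = q) (c : MvPolynomial (Fin n) k) :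
    Finsupp.lmapDomain (MvPolynomial (Fin n) k) (MvPolynomial (Fin n) k)
      (fun a : EKIdx I (q + 1) => a.1) (c • eEK I q F m) = Finsupp.single (F, m) c := by
  rw [map_smul, eEK_eq_single h, Finsupp.lmapDomain_apply, Finsupp.mapDomain_single,
    Finsupp.smul_single, smul_eq_mul, mul_one]

/-- No two terms involve the same basis element. Within each sum the erased index tells them apart,
and between the sums the generator does, since `φ i ≠ m`. -/
lemma card_support_sub {q : ℕ} {F : Finset (Fin n)} {m : Fin n →₀ ℕ}
    (h : EKAdmissible I F m ∧ F.card = q + 1) (φ : Fin n → (Fin n →₀ ℕ)) {A : Finset (Fin n)}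
    (hA : A ⊆ F) (hφ : ∀ i ∈ A, EKAdmissible I (F.erase i) (φ i)) (hne : ∀ i ∈ A, φ i ≠ m)
    {c₁ c₂ : Fin n → MvPolynomial (Fin n) k} (hc₁ : ∀ i ∈ F, c₁ i ≠ 0) (hc₂ : ∀ i ∈ A, c₂ i ≠ 0) :
    (∑ i ∈ F, c₁ i • eEK I q (F.erase i) m -
      ∑ i ∈ A, c₂ i • eEK I q (F.erase i) (φ i)).support.card = F.card + A.card := by
  classical
  have hcard : ∀ i ∈ F, (F.erase i).card = q := fun i hi => by
    rw [Finset.card_erase_of_mem hi, h.2]; rfl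
  have hinj : Function.Injective (fun a : EKIdx I (q + 1) => a.1) := fun _ _ => Subtype.ext
  rw [← Finset.card_image_of_injective _ hinj, ← Finsupp.mapDomain_support_of_injective hinj,
    ← Finsupp.lmapDomain_apply (MvPolynomial (Fin n) k) (MvPolynomial (Fin n) k), map_sub, map_sum,
    map_sum,
    Finset.sum_congr rfl fun i hi => mapDomain_smul_eEK ⟨h.1.erase i, hcard i hi⟩ (c₁ i),
    Finset.sum_congr rfl fun i hi => mapDomain_smul_eEK ⟨hφ i hi, hcard i (hA hi)⟩ (c₂ i)]
  have hsum : ∑ i ∈ F, Finsupp.single (F.erase i, m) (c₁ i) -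
      ∑ i ∈ A, Finsupp.single (F.erase i, φ i) (c₂ i) =
      ∑ x ∈ F.disjSum A, Finsupp.single
        (Sum.elim (fun i => (F.erase i, m)) (fun i => (F.erase i, φ i)) x)
        (Sum.elim c₁ (fun i => -c₂ i) x) := by
    rw [Finset.sum_disjSum, sub_eq_add_neg, ← Finset.sum_neg_distrib]
    simp only [Sum.elim_inl, Sum.elim_inr, Finsupp.single_neg]
  rw [hsum, support_sum_single, Finset.card_image_of_injOn, Finset.card_disjSum]
  · rintro (i | i) hi (j | j) hj hij <;>
    simp only [Finset.mem_coe, Finset.inl_mem_disjSum, Finset.inr_mem_disjSum] at hi hj <;>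
    simp only [Sum.elim_inl, Sum.elim_inr, Prod.mk.injEq] at hij
    · rw [F.erase_injOn hi hj hij.1]
    · exact absurd hij.2.symm (hne j hj)
    · exact absurd hij.2 (hne i hi)
    · rw [F.erase_injOn (hA hi) (hA hj) hij.1]
  · rintro (i | i) hi (j | j) hj hij <;>
    simp only [Finset.mem_coe, Finset.inl_mem_disjSum, Finset.inr_mem_disjSum] at hi hj <;>
    simp only [Sum.elim_inl, Sum.elim_inr, Prod.mk.injEq] at hij
    · rw [F.erase_injOn hi hj hij.1]
    · exact absurd hij.2.symm (hne j hj)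
    · exact absurd hij.2 (hne i hi)
    · rw [F.erase_injOn (hA hi) (hA hj) hij.1]
  · rintro (i | i) hi
    · exact hc₁ i (Finset.inl_mem_disjSum.mp hi)
    · exact neg_ne_zero.mpr (hc₂ i (Finset.inr_mem_disjSum.mp hi))

lemma sg_ne_zero (F : Finset (Fin n)) (i : Fin n) : sg k F i ≠ 0 :=
  pow_ne_zero _ (neg_ne_zero.mpr one_ne_zero)

lemma sg_mul_X_ne_zero (F : Finset (Fin n)) (i : Fin n) : sg k F i * X i ≠ 0 :=
  mul_ne_zero (sg_ne_zero F i) (X_ne_zero i)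

lemma sg_mul_monomial_ne_zero (F : Finset (Fin n)) (i : Fin n) (u : Fin n →₀ ℕ) :
    sg k F i * monomial u 1 ≠ 0 :=
  mul_ne_zero (sg_ne_zero F i) (by rw [Ne, monomial_eq_zero]; exact one_ne_zero)

open Classical in
lemma card_support_sdiff (hI : IsBorelFixed I) {q : ℕ} {F : Finset (Fin n)} {m : Fin n →₀ ℕ}
    (h : EKAdmissible I F m ∧ F.card = q + 1) :
    (sdiff I (q + 1) (eEK I (q + 1) F m)).support.card =
      F.card + (F.filter (Good I F m)).card := by
  rw [sdiff_succ_eEK h]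
  have : ∑ i ∈ F, sg k F i • dterm I q F m i =
      ∑ i ∈ F, (sg k F i * X i) • eEK I q (F.erase i) m -
      ∑ i ∈ F.filter (Good I F m), (sg k F i *
        monomial (Finsupp.single i 1 + m - bracket I m i) 1) •
          eEK I q (F.erase i) (bracket I m i) := by
    rw [Finset.sum_filter, ← Finset.sum_sub_distrib]
    refine Finset.sum_congr rfl fun i _ => ?_
    rw [dterm, smul_sub, smul_ite, smul_zero, smul_smul, smul_smul]
  rw [this]
  refine card_support_sub h _ (Finset.filter_subset _ _) (fun i hi => ?_) (fun i hi heq => ?_)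
    (fun i _ => sg_mul_X_ne_zero F i) (fun i _ => sg_mul_monomial_ne_zero F i _)
  · exact h.1.erase_bracket hI (Finset.mem_filter.mp hi).1 (Finset.mem_filter.mp hi).2
  · have := wt_bracket_lt hI h.1.1 (h.1.ps_lt (Finset.mem_filter.mp hi).1)
    rw [heq] at this
    exact lt_irrefl _ this

open Classical in
lemma card_support_ekdiff {q : ℕ} {F : Finset (Fin n)} {m : Fin n →₀ ℕ}
    (h : EKAdmissible I F m ∧ F.card = q + 1) (hne : ∀ i ∈ F, g I (Finsupp.single i 1 + m) ≠ m) :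
    (ekdiff I (q + 1) (eEK I (q + 1) F m)).support.card = F.card +
      (F.filter (fun i => EKAdmissible I (F.erase i) (g I (Finsupp.single i 1 + m)))).card := by
  have : ekdiff I (q + 1) (eEK I (q + 1) F m) =
      ∑ i ∈ F, (sg k F i * X i) • eEK I q (F.erase i) m -
      ∑ i ∈ F.filter (fun i => EKAdmissible I (F.erase i) (g I (Finsupp.single i 1 + m))),
        (sg k F i * monomial (Finsupp.single i 1 + m - g I (Finsupp.single i 1 + m)) 1) •
          eEK I q (F.erase i) (g I (Finsupp.single i 1 + m)) := by
    rw [eEK_eq_single h, ekdiff]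
    exact (Finsupp.linearCombination_single _ _ _).trans (one_smul _ _)
  rw [this]
  exact card_support_sub h _ (Finset.filter_subset _ _) (fun i hi => (Finset.mem_filter.mp hi).2)
    (fun i hi => hne i (Finset.mem_filter.mp hi).1)
    (fun i _ => sg_mul_X_ne_zero F i) (fun i _ => sg_mul_monomial_ne_zero F i _)

lemma card_support_repr {d : ℕ} [NeZero d] (hd : ∀ m ∈ G I, m.degree ≤ d) (q : ℕ)
    (z : TP I d q) :
    ((tbasis I d q).repr z).support.card = (corrMap I d q z).support.card := by
  refine Finset.card_bij (fun a _ => corr I d q a) (fun a ha => ?_)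
    (fun a _ b _ hab => corr_injective q hab) fun b hb => ?_
  · rw [Finsupp.mem_support_iff] at ha ⊢
    rwa [corrMap_apply_corr]
  · obtain ⟨a, rfl⟩ := corr_surjective hd q b
    rw [Finsupp.mem_support_iff, corrMap_apply_corr] at hb
    exact ⟨a, Finsupp.mem_support_iff.mpr hb, rfl⟩

end Support

/-! ### The example -/

section Example

variable {k : Type*} [Field k]

lemma exampleIdeal_eq_span : exampleIdeal k = Ideal.span ((fun a => monomial a (1 : k)) ''
    {Finsupp.single 0 2, Finsupp.single 0 1 + Finsupp.single 1 1,
      Finsupp.single 0 1 + Finsupp.single 2 1, Finsupp.single 0 1 + Finsupp.single 3 1,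
      Finsupp.single 1 2, Finsupp.single 1 1 + Finsupp.single 2 1,
      Finsupp.single 1 1 + Finsupp.single 3 1}) := by
  have h1 : ∀ i : Fin 4, (X i : MvPolynomial (Fin 4) k) ^ 2 = monomial (Finsupp.single i 2) 1 :=
    fun i => X_pow_eq_monomial
  have h2 : ∀ i j : Fin 4, (X i : MvPolynomial (Fin 4) k) * X j =
      monomial (Finsupp.single i 1 + Finsupp.single j 1) 1 := fun i j => by
    rw [X, X, monomial_mul, one_mul]
  rw [exampleIdeal]
  simp only [Set.image_insert_eq, Set.image_singleton, h1, h2]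

/-- The generators are all the quadratic monomials divisible by `x_0` or `x_1`, so membership
becomes a linear condition on exponents. -/
lemma monomial_mem_exampleIdeal_iff (a : Fin 4 →₀ ℕ) : monomial a (1 : k) ∈ exampleIdeal k ↔
    1 ≤ a 0 + a 1 ∧ 2 ≤ a 0 + a 1 + a 2 + a 3 := by
  classical
  rw [exampleIdeal_eq_span, mem_ideal_span_monomial_image,
    support_monomial, if_neg one_ne_zero]
  simp only [Finset.mem_singleton, forall_eq, Set.mem_insert_iff, Set.mem_singleton_iff,
    exists_eq_or_imp, exists_eq_left, Finsupp.le_def, Fin.forall_fin_succ, Finsupp.add_apply,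
    Finsupp.single_apply]
  simp
  omega

lemma degree_fin_four (a : Fin 4 →₀ ℕ) : a.degree = a 0 + a 1 + a 2 + a 3 := by
  rw [Finsupp.degree_eq_sum, Fin.sum_univ_four]

lemma mem_G_exampleIdeal {a : Fin 4 →₀ ℕ} (h1 : 1 ≤ a 0 + a 1) (h2 : a.degree = 2) :
    a ∈ G (exampleIdeal k) := by
  have hd := degree_fin_four a
  refine ⟨(monomial_mem_exampleIdeal_iff a).mpr ⟨h1, by omega⟩, fun b hb hle => ?_⟩
  have h3 := (monomial_mem_exampleIdeal_iff b).mp hb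
  intro i
  have := hle 0
  have := hle 1
  have := hle 2
  have := hle 3
  fin_cases i <;> simp <;> omega

lemma degree_le_of_mem_G_exampleIdeal {m : Fin 4 →₀ ℕ} (hm : m ∈ G (exampleIdeal k)) :
    m.degree ≤ 2 := by
  by_contra! hlt
  have h1 := (monomial_mem_exampleIdeal_iff m).mp hm.1
  rw [degree_fin_four] at hlt
  -- Dividing a minimal generator by any of its variables leaves the ideal. In degree three or more
  -- some variable could be removed without leaving it.
  have key : ∀ i : Fin 4, m i ≠ 0 → ¬ monomial (m - Finsupp.single i 1) (1 : k) ∈ exampleIdeal k := by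
    intro i hi h
    have := hm.2 h tsub_le_self i
    rw [Finsupp.tsub_apply, Finsupp.single_eq_same] at this
    omega
  simp only [monomial_mem_exampleIdeal_iff, Finsupp.tsub_apply, Finsupp.single_apply,
    Fin.forall_fin_succ] at key
  simp at key
  omega

lemma isBorelFixed_exampleIdeal : IsBorelFixed (exampleIdeal k) := by
  refine ⟨⟨_, exampleIdeal_eq_span⟩, fun m hm i j hi hji => ?_⟩
  have h1 := (monomial_mem_exampleIdeal_iff m).mp hm.1
  rw [monomial_mem_exampleIdeal_iff]
  simp only [Finsupp.add_apply, Finsupp.tsub_apply, Finsupp.single_apply]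
  fin_cases i <;> fin_cases j <;> simp at hi hji ⊢ <;> omega

lemma exampleIdeal_ne_top : exampleIdeal k ≠ ⊤ := by
  rw [Ne, Ideal.eq_top_iff_one]
  intro h
  have := (monomial_mem_exampleIdeal_iff (k := k) 0).mp h
  simp at this

/-- The monomial `x_1 x_3` (`x_2 x_4` if indices start at `1`). -/
def exampleMonomial : Fin 4 →₀ ℕ := Finsupp.single 1 1 + Finsupp.single 3 1

lemma ps_exampleMonomial (t : ℕ) : ps exampleMonomial t =
    (if 1 < t then 1 else 0) + if 3 < t then 1 else 0 := by
  rw [exampleMonomial, ps_add, ps_single, ps_single]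
  rfl

lemma degree_exampleMonomial : exampleMonomial.degree = 2 := by
  rw [exampleMonomial, map_add, Finsupp.degree_single, Finsupp.degree_single]

lemma ekAdmissible_exampleMonomial :
    EKAdmissible (exampleIdeal k) {0, 1, 2} exampleMonomial ∧
      ({0, 1, 2} : Finset (Fin 4)).card = 2 + 1 := by
  refine ⟨⟨mem_G_exampleIdeal (by simp [exampleMonomial]) degree_exampleMonomial, fun i hi => ?_⟩,
    rfl⟩
  rw [lt_nu_iff, degree_exampleMonomial, ps_exampleMonomial]
  fin_cases i <;> simp at hi ⊢

/-- A quadratic monomial of the ideal is already a minimal generator, so `g` changes nothing here.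
-/
lemma bracket_exampleMonomial {i : Fin 4} (hi : i.val < 3) {a : Fin 4 →₀ ℕ}
    (h1 : 1 ≤ a 0 + a 1) (h2 : a.degree = 2)
    (h : ∀ t, ps a t = if i.val < t then max (ps exampleMonomial t)
      (ps exampleMonomial (i + 1) + 1) else ps exampleMonomial t) :
    bracket (exampleIdeal k) exampleMonomial i = a := by
  have hlt : ps exampleMonomial (i + 1) < exampleMonomial.degree := by
    rw [ps_exampleMonomial, degree_exampleMonomial]
    split_ifs <;> omega
  rw [bracket_eq hlt, show fb i exampleMonomial = a from eq_of_ps_eq fun t => by rw [ps_fb hlt, h],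
    g_eq_self isBorelFixed_exampleIdeal (mem_G_exampleIdeal h1 h2)]

lemma bracket_exampleMonomial_zero : bracket (exampleIdeal k) exampleMonomial 0 =
    Finsupp.single 0 1 + Finsupp.single 3 1 := by
  refine bracket_exampleMonomial (by decide) (by simp) (by simp) fun t => ?_
  simp only [ps_exampleMonomial, ps_add, ps_single]
  simp
  split_ifs <;> omega

lemma bracket_exampleMonomial_one : bracket (exampleIdeal k) exampleMonomial 1 =
    Finsupp.single 1 2 := by
  refine bracket_exampleMonomial (by decide) (by simp) (by simp) fun t => ?_
  simp only [ps_exampleMonomial, ps_single]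
  simp
  split_ifs <;> omega

lemma bracket_exampleMonomial_two : bracket (exampleIdeal k) exampleMonomial 2 =
    Finsupp.single 1 1 + Finsupp.single 2 1 := by
  refine bracket_exampleMonomial (by decide) (by simp) (by simp) fun t => ?_
  simp only [ps_exampleMonomial, ps_add, ps_single]
  simp
  split_ifs <;> omega

-- The brackets of `x_1 x_3` at `0, 1, 2` are `x_0 x_3`, `x_1²` and `x_1 x_2`. Only `x_1²` fails:
-- its partial sum at the remaining index `2` has grown from `1` to `2`.
open Classical in
lemma filter_good_exampleMonomial :
    Finset.filter (Good (exampleIdeal k) {0, 1, 2} exampleMonomial) {0, 1, 2} = {0, 2} := by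
  have h0 : Good (exampleIdeal k) {0, 1, 2} exampleMonomial 0 := by
    intro f hf hne
    rw [bracket_exampleMonomial_zero, ps_exampleMonomial, ps_add, ps_single, ps_single]
    fin_cases f <;> simp at hf hne ⊢
  have h1 : ¬ Good (exampleIdeal k) {0, 1, 2} exampleMonomial 1 := by
    intro h
    have := (h 2 (by simp) (by simp)).1
    rw [bracket_exampleMonomial_one, ps_exampleMonomial, ps_single] at this
    simp at this
  have h2 : Good (exampleIdeal k) {0, 1, 2} exampleMonomial 2 := by
    intro f hf hne
    rw [bracket_exampleMonomial_two, ps_exampleMonomial, ps_add, ps_single, ps_single]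
    fin_cases f <;> simp at hf hne ⊢
  rw [Finset.filter_insert, if_pos h0, Finset.filter_insert, if_neg h1, Finset.filter_singleton,
    if_pos h2]

lemma g_add_of_le {n : ℕ} {I : Ideal (MvPolynomial (Fin n) k)} (hI : IsBorelFixed I)
    {a b : Fin n →₀ ℕ} (ha : a ∈ G I) (h : ∀ i ∈ a.support, ∀ j ∈ b.support, i ≤ j) :
    g I (a + b) = a :=
  g_eq_of_ps hI (mem_of_le le_self_add ha.1) ha (ps_eq_min_of_add h)

lemma g_add_single_three {a : Fin 4 →₀ ℕ} (h1 : 1 ≤ a 0 + a 1) (h2 : a.degree = 2) :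
    g (exampleIdeal k) (a + Finsupp.single 3 1) = a := by
  refine g_add_of_le isBorelFixed_exampleIdeal (mem_G_exampleIdeal h1 h2) fun i _ j hj => ?_
  rw [Finset.mem_singleton.mp (Finsupp.support_single_subset hj)]
  exact Fin.le_last i

lemma g_single_add_exampleMonomial (i : Fin 4) :
    g (exampleIdeal k) (Finsupp.single i 1 + exampleMonomial) =
      Finsupp.single i 1 + Finsupp.single 1 1 := by
  rw [exampleMonomial, ← add_assoc]
  refine g_add_single_three ?_ (by rw [map_add, Finsupp.degree_single, Finsupp.degree_single])
  simp only [Finsupp.add_apply, Finsupp.single_eq_same]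
  omega

-- Here `g (x_i x_1 x_3) = x_i x_1`. For `i = 0, 1` its largest index is `1`, too small for the
-- remaining index `2`; for `i = 2` the remaining indices `0, 1` are below `2`.
open Classical in
lemma filter_ekAdmissible_exampleMonomial :
    Finset.filter (fun i => EKAdmissible (exampleIdeal k) (Finset.erase {0, 1, 2} i)
      (g (exampleIdeal k) (Finsupp.single i 1 + exampleMonomial))) {0, 1, 2} = {2} := by
  have hdeg : ∀ i : Fin 4, (Finsupp.single i 1 + Finsupp.single 1 1 : Fin 4 →₀ ℕ).degree = 2 :=
    fun i => by rw [map_add, Finsupp.degree_single, Finsupp.degree_single]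
  have key : ∀ i : Fin 4, i ∈ ({0, 1} : Finset (Fin 4)) →
      ¬ EKAdmissible (exampleIdeal k) (Finset.erase {0, 1, 2} i)
        (g (exampleIdeal k) (Finsupp.single i 1 + exampleMonomial)) := by
    intro i hi h
    have hi2 : i ≠ 2 := by
      fin_cases i <;> simp at hi ⊢
    have := h.ps_lt (Finset.mem_erase.mpr ⟨hi2.symm, by simp⟩)
    rw [g_single_add_exampleMonomial, ps_add, ps_single, ps_single, hdeg] at this
    fin_cases i <;> simp at hi this
  have h2 : EKAdmissible (exampleIdeal k) (Finset.erase {0, 1, 2} 2)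
      (g (exampleIdeal k) (Finsupp.single 2 1 + exampleMonomial)) := by
    rw [g_single_add_exampleMonomial]
    refine ⟨mem_G_exampleIdeal (by simp) (hdeg 2), fun i hi => ?_⟩
    rw [lt_nu_iff, ps_add, ps_single, ps_single, hdeg]
    fin_cases i <;> simp at hi ⊢
  rw [Finset.filter_insert, if_neg (key 0 (by simp)), Finset.filter_insert,
    if_neg (key 1 (by simp)), Finset.filter_singleton, if_pos h2]

lemma card_support_sdiff_exampleMonomial :
    (sdiff (exampleIdeal k) 3 (eEK (exampleIdeal k) 3 {0, 1, 2} exampleMonomial)).support.card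
      = 5 := by
  rw [card_support_sdiff isBorelFixed_exampleIdeal ekAdmissible_exampleMonomial,
    filter_good_exampleMonomial]
  rfl

lemma card_support_ekdiff_exampleMonomial :
    (ekdiff (exampleIdeal k) 3 (eEK (exampleIdeal k) 3 {0, 1, 2} exampleMonomial)).support.card
      = 4 := by
  rw [card_support_ekdiff ekAdmissible_exampleMonomial, filter_ekAdmissible_exampleMonomial]
  · rfl
  · intro i hi heq
    rw [g_single_add_exampleMonomial, exampleMonomial, add_comm, add_right_inj] at heq
    have := Finsupp.single_left_injective one_ne_zero heq
    subst this
    simp at hi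

lemma exists_card_support_example : ∃ a : Idx (exampleIdeal k) 2 4,
    (corrMap (exampleIdeal k) 2 3 (tdiff (exampleIdeal k) 2 3
      (tbasis (exampleIdeal k) 2 4 a))).support.card = 5 ∧
    (ekdiff (exampleIdeal k) 3
      (Finsupp.single (corr (exampleIdeal k) 2 4 a) 1)).support.card = 4 := by
  obtain ⟨a, ha⟩ := corr_surjective (fun m => degree_le_of_mem_G_exampleIdeal (k := k)) 4
    ⟨({0, 1, 2}, exampleMonomial), ekAdmissible_exampleMonomial⟩
  have ha1 : (corr (exampleIdeal k) 2 4 a).1.1 = {0, 1, 2} := by rw [ha]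
  have ha2 : (corr (exampleIdeal k) 2 4 a).1.2 = exampleMonomial := by rw [ha]
  refine ⟨a, ?_, ?_⟩
  · rw [corrMap_tdiff_basis isBorelFixed_exampleIdeal
      (fun m => degree_le_of_mem_G_exampleIdeal), single_eq_eEK, ha1, ha2]
    exact card_support_sdiff_exampleMonomial
  · rw [single_eq_eEK, ha1, ha2]
    exact card_support_ekdiff_exampleMonomial

end Example

end

end BorelEK

theorem mainTheorem3 (k : Type*) [Field k] :
    (∀ (n d : ℕ) [NeZero d] (I : Ideal (MvPolynomial (Fin n) k)),
      BorelEK.IsBorelFixed I → I ≠ ⊤ → (∀ m ∈ BorelEK.G I, m.degree ≤ d) →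
        BorelEK.IsMinimalFreeResolution (C := BorelEK.TP I d)
          (BorelEK.tdiff I d) (BorelEK.augmentation I d) ∧
        BorelEK.IsMultigraded (C := BorelEK.TP I d)
          (BorelEK.tdiff I d) (BorelEK.tbasis I d) (BorelEK.mdeg I d) ∧
        ∀ q, Function.Bijective (BorelEK.corr I d q)) ∧
    (BorelEK.IsBorelFixed (BorelEK.exampleIdeal k) ∧ BorelEK.exampleIdeal k ≠ ⊤ ∧
      (∀ m ∈ BorelEK.G (BorelEK.exampleIdeal k), m.degree ≤ 2) ∧
      (¬ ∀ q, BorelEK.corrMap (BorelEK.exampleIdeal k) 2 q ∘ₗ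
            BorelEK.tdiff (BorelEK.exampleIdeal k) 2 q =
          BorelEK.ekdiff (BorelEK.exampleIdeal k) q ∘ₗ
            BorelEK.corrMap (BorelEK.exampleIdeal k) 2 (q + 1)) ∧
      ∃ a : BorelEK.Idx (BorelEK.exampleIdeal k) 2 4,
        ((BorelEK.tbasis (BorelEK.exampleIdeal k) 2 3).repr
          (BorelEK.tdiff (BorelEK.exampleIdeal k) 2 3
            (BorelEK.tbasis (BorelEK.exampleIdeal k) 2 4 a))).support.card = 5 ∧
        (BorelEK.ekdiff (BorelEK.exampleIdeal k) 3
          (Finsupp.single (BorelEK.corr (BorelEK.exampleIdeal k) 2 4 a) 1)).support.card = 4) := by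
  refine ⟨fun n d _ I hI htop hd => ⟨BorelEK.isMinimalFreeResolution hI htop hd,
    BorelEK.isMultigraded hI hd,
    fun q => ⟨BorelEK.corr_injective q, BorelEK.corr_surjective hd q⟩⟩,
    BorelEK.isBorelFixed_exampleIdeal, BorelEK.exampleIdeal_ne_top,
    fun m => BorelEK.degree_le_of_mem_G_exampleIdeal, fun hall => ?_, ?_⟩
  -- A chain map would identify the images of this basis element, but one has five terms and the
  -- other four.
  · obtain ⟨a, h5, h4⟩ := BorelEK.exists_card_support_example (k := k)
    have h := LinearMap.congr_fun (hall 3) (BorelEK.tbasis (BorelEK.exampleIdeal k) 2 4 a)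
    rw [LinearMap.comp_apply, LinearMap.comp_apply, BorelEK.tbasis_apply (q := 4),
      BorelEK.corrMap_toTP_single, ← BorelEK.tbasis_apply] at h
    rw [h, h4] at h5
    exact absurd h5 (by decide)
  · obtain ⟨a, h5, h4⟩ := BorelEK.exists_card_support_example (k := k)
    refine ⟨a, ?_, h4⟩
    rw [BorelEK.card_support_repr fun m => BorelEK.degree_le_of_mem_G_exampleIdeal]
    exact h5
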